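/- **Setting.** Let $N,n\ge 1$. The leader ($i=0$) and the followers ($i=1,\dots,N$) satisfy, for $t\ge 0$, $\dot x_{ik}=x_{i(k+1)}+f_{ik}(x_{i1},\dots,x_{ik})+d_{ik}(t)$, $k=1,\dots,n$, with $x_{i(n+1)}:=u_i$ and output $y_i=x_{i1}$. The $f_{ik}$ are smooth, the $d_{ik}$ differentiable with $|d_{ik}|<\bar d_{ik}$, $|\dot d_{ik}|<\bar d_{d,ik}$, and the leader's input $u_0$ is an arbitrary function of time. The followers communicate over a weighted directed or undirected graph with weights $a_{il}\ge0$, $a_{ii}=0$, and with weights $b_i\ge0$ of the edges from the leader; the graph with the leader contains a spanning tree rooted at the leader. Put $g_i=\sum_l a_{il}+b_i$, $\tilde L=L+B$ with $L$ the Laplacian and $B=\mathrm{diag}(b_i)$, and $p=\tfrac13$, $q=3$. Odd powers of vectors and numbers are taken componentwise with sign. **Controller.** Let $e_i=\sum_l a_{il}(y_i-y_l)+b_i(y_i-y_0)$, $\zeta_{i1}=e_i$, $\zeta_{ik}=x_{ik}-\alpha_{i(k-1)}$ for $k\ge2$, $\zeta_{i(n+1)}=0$, $\kappa_{i1}=g_i$,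 $\kappa_{ik}=1$ for $k\ge 2$. The controls are $\alpha_{ik}=\hat v^*_{ik}+h_{ik}$, $u_i=\alpha_{in}$, with $$\hat v^*_{ik}=-\tfrac1{\kappa_{ik}}\bigl(k_{ik}\zeta_{ik}+\hat W_{a,ik}^\top S_{ik}(\zeta_{ik})\bigr),\qquad h_{ik}=-\tfrac1{\kappa_{ik}}\bigl(k_{p,ik}\zeta_{ik}^p+k_{q,ik}\zeta_{ik}^q+\hat\theta_{ik}^\top\Phi_{ik}(\chi_{ik})+\hat d_{ik}+r_{ik}\bigr),$$ $r_{i1}=0$, $r_{i2}=g_ie_i$, $r_{ik}=\zeta_{i(k-1)}$ for $k\ge3$; $\chi_{ik}$ consists of $x_{i1},\dots,x_{ik}$ and of all weights and estimates $\hat W_c,\hat W_a,\hat\theta,\hat d$ of follower $i$ in the layers before $k$. The adaptation laws are (with $S=S_{ik}(\zeta_{ik})$, $\Phi=\Phi_{ik}(\chi_{ik})$, indices $ik$ omitted) $$\dot{\hat W}_c=\Gamma_c\bigl(-S\zeta-\sigma_{1c}SS^\top\hat W_c-\sigma_{2c}\hat W_c^p-\sigma_{3c}\hat W_c^q\bigr),$$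 $$\dot{\hat W}_a=-\Gamma_a\bigl(\sigma_{1a}SS^\top(\hat W_a-\hat W_c)+\sigma_{2a}(\hat W_a-\hat W_c)^p+\sigma_{3a}(\hat W_a-\hat W_c)^q\bigr),$$ $$\dot{\hat\theta}=\Gamma_\theta\bigl(\zeta\Phi-\sigma_{1\theta}\hat\theta^p-\sigma_{2\theta}\hat\theta^q\bigr),\qquad \dot{\hat d}=\gamma\bigl(\zeta-\sigma_{1d}\hat d^p-\sigma_{2d}\hat d^q\bigr).$$ The parameters satisfy, for all $i,k$: $k>\tfrac32$; $\sigma_{1c}>\sigma_{1a}>1$; $\sigma_{2c}>2\sigma_{2a}>0$; $0<\sigma_{3a}<\sigma_{3c}/(8\cdot172)$; $\sigma_{2d}>2/\mu^4$ with a constant $\mu>0$; $k_p,k_q,\sigma_{1\theta},\sigma_{2\theta},\sigma_{1d},\gamma>0$; $\Gamma_c,\Gamma_a,\Gamma_\theta$ symmetric positive definite. All networks have at least one neuron, and $S_{ik}(\cdot)^\top S_{ik}(\cdot)\le\bar\lambda_{s,ik}$. **Unknown terms.** Let $F_{i1}=g_if_{i1}-\sum_l a_{il}(x_{l2}+f_{l1})-b_i(x_{02}+f_{01})$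 and $F_{ik}=f_{ik}-\dot\alpha_{i(k-1)}$ for $k\ge2$. Consider closed-loop solutions on $[0,\infty)$, from any initial state, along which the virtual controls are differentiable and the estimator networks with constant ideal weights $\theta^*_{ik}$ satisfy $(F_{ik}-\theta_{ik}^{*\top}\Phi_{ik}(\chi_{ik}))^2\le\bar\delta_{ik}$. Let $W^*_{ik}$ be the constant ideal actor-critic weights. **Constants.** Let $\bar D_{i1}=g_i\bar d_{i1}+\sum_la_{il}\bar d_{l1}+b_i\bar d_{01}$ and $\bar D_{ik}=\bar d_{ik}$ for $k\ge2$; define $\bar D_{d,ik}$ in the same way from the $\bar d_{d,ik}$. Let $|v|_s^s=\sum_l|v_l|^s$ and $C=\sum_{i,k}C_{ik}$ with (indices $ik$ omitted) $$C_{ik}=\tfrac12\bar\delta+\tfrac{\sigma_{1c}}2\bar\lambda_s\|W^*\|^2+\sigma_{2c}|W^*|_{4/3}^{4/3}+172\sigma_{3c}|W^*|_4^4+\sigma_{1\theta}|\theta^*|_{4/3}^{4/3}+172\sigma_{2\theta}|\theta^*|_4^4+\sigma_{1d}\bar D^{4/3}+172\sigma_{2d}\bar D^4+\tfrac34\bigl(\tfrac\mu\gamma\bigr)^{4/3}\bar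 D_d^{4/3}.$$ Let $\bar\lambda_c,\bar\lambda_a,\bar\lambda_\theta$ be the largest eigenvalues of all the $\Gamma_{c,ik}^{-1}$, $\Gamma_{a,ik}^{-1}$, $\Gamma_{\theta,ik}^{-1}$, let $M_S$ be the total number of neurons of the critic networks (equal to that of the actor networks) and $M_\Phi$ that of the estimator networks, and put (minima over all $i,k$) $$k_p=\min\Bigl\{2^{\frac23}\min k_{p,ik},\ \bigl(\tfrac2{\bar\lambda_c}\bigr)^{\frac23}\min\bigl(\tfrac{\sigma_{2c}}2-\sigma_{2a}\bigr),\ \tfrac12\bigl(\tfrac2{\bar\lambda_a}\bigr)^{\frac23}\min\sigma_{2a},\ \tfrac12\bigl(\tfrac2{\bar\lambda_\theta}\bigr)^{\frac23}\min\sigma_{1\theta},\ \tfrac12(2\min\gamma)^{\frac23}\min\sigma_{1d}\Bigr\},$$ $$k_q=\tfrac15\min\Bigl\{\tfrac{4\min k_{q,ik}}{nN},\ \tfrac{4}{\bar\lambda_c^2M_S}\min\bigl(\tfrac{\sigma_{3c}}8-172\sigma_{3a}\bigr),\ \tfrac{4}{\bar\lambda_a^2M_S}\min\tfrac{\sigma_{3a}}8,\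 \tfrac{4}{\bar\lambda_\theta^2M_\Phi}\min\tfrac{\sigma_{2\theta}}8,\ \tfrac{4(\min\gamma)^2}{nN}\min\bigl(\tfrac{\sigma_{2d}}8-\tfrac1{4\mu^4}\bigr)\Bigr\}.$$ With $\tilde p=\frac{p+1}2=\frac23$, $\tilde q=\frac{q+1}2=2$ and $0<\vartheta<1$, let $$T_{\max}=\frac1{k_p(1-\tilde p)}+\frac1{k_q(\tilde q-1)},\qquad \Omega_e=\sqrt{2\min\Bigl\{\bigl(\tfrac C{(1-\vartheta)k_p}\bigr)^{1/\tilde p},\bigl(\tfrac C{(1-\vartheta)k_q}\bigr)^{1/\tilde q}\Bigr\}},\qquad \Omega_z=\frac{\Omega_e}{\underline\lambda_{\tilde L}},$$ where $\underline\lambda_{\tilde L}$ is the smallest singular value of $\tilde L$. **Theorem.** (i) For every such solution there is a time $T\ge0$ with $T<T_{\max}/\vartheta$, and also $T<T_{\max}$ if $\vartheta\ge\frac9{10}$, such that for all $t\ge T$ the consensus errors satisfy $\|(e_i(t))_i\|\le\Omega_e$ and the tracking errors satisfy $\|(y_i(t)-y_0(t))_i\|\le\Omega_z$ (Euclidean norms);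 in particular, the bound on $T$ is independent of the initial state. If the graph of the followers is undirected ($a_{il}=a_{li}$), then $\|(y_i(t)-y_0(t))_i\|\le\Omega_e/\lambda_{\min}(\tilde L)$ for these $t$, with the smallest eigenvalue $\lambda_{\min}(\tilde L)$. (ii) The radius is adjustable: with the coefficients $\sigma,\mu$, the bounds $\bar d,\bar d_d,\bar\delta,\bar\lambda_s$, the ideal weights and $\vartheta$ fixed, for every $\varepsilon>0$ there is $R$ such that $\Omega_z\le\varepsilon$ whenever $k_{p,ik},k_{q,ik},\gamma_{ik}\ge R$ and $\Gamma_{c,ik},\Gamma_{a,ik},\Gamma_{\theta,ik}\succeq R\,I$ for all $i,k$. -/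

import Mathlib

open scoped ContDiff Matrix

noncomputable section

namespace FixedTimeConsensus

/-! ### Powers and extreme eigenvalues -/

/-- The odd real power `x ^ r` for a ratio `r > 0` of odd numbers: `sign x * |x| ^ r`. -/
def oddPow (r x : ℝ) : ℝ := Real.sign x * |x| ^ r

/-- Componentwise odd power of a vector. -/
def oddPowVec {m : ℕ} (r : ℝ) (v : Fin m → ℝ) : Fin m → ℝ := fun l => oddPow r (v l)

/-- `‖v ^ (s / 2)‖ ^ 2`, that is `∑ |v_l| ^ s`. -/
def powSum {m : ℕ} (s : ℝ) (v : Fin m → ℝ) : ℝ := ∑ l, |v l| ^ s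

/-- The exponent `p = 1 / 3` of the control and adaptation laws. -/
def p : ℝ := 1 / 3

/-- The exponent `q = 3` of the control and adaptation laws. -/
def q : ℝ := 3

/-- The Lyapunov exponent `(p + 1) / 2`. -/
def pLyap : ℝ := (p + 1) / 2

/-- The Lyapunov exponent `(q + 1) / 2`. -/
def qLyap : ℝ := (q + 1) / 2

/-- Largest eigenvalue of a real symmetric matrix. -/
def lamMax {m : ℕ} (M : Matrix (Fin m) (Fin m) ℝ) : ℝ := sSup (spectrum ℝ M)

/-- Smallest eigenvalue of a real symmetric matrix. -/
def lamMin {m : ℕ} (M : Matrix (Fin m) (Fin m) ℝ) : ℝ := sInf (spectrum ℝ M)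

/-- Smallest singular value of a real square matrix. -/
def singMin {m : ℕ} (M : Matrix (Fin m) (Fin m) ℝ) : ℝ := √(lamMin (Mᵀ * M))

/-- Euclidean norm of a vector. -/
def eucl {m : ℕ} (v : Fin m → ℝ) : ℝ := √(∑ i, v i ^ 2)

/-! ### Communication graph -/

/-- A weighted directed graph on `N` followers and a leader: `a i l` is the weight of the edge
from follower `l` to follower `i`, and `b i` the weight of the edge from the leader to
follower `i`. Undirected communication between the followers is the case `a i l = a l i`. -/
structure Topology (N : ℕ) where
  a : Fin N → Fin N → ℝ
  b : Fin N → ℝ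
  a_nonneg : ∀ i l, 0 ≤ a i l
  a_self : ∀ i, a i i = 0
  b_nonneg : ∀ i, 0 ≤ b i

namespace Topology

variable {N : ℕ} (G : Topology N)

/-- `G.Edge u v`: there is an edge from `u` to `v`; the leader is `none`. -/
def Edge : Option (Fin N) → Option (Fin N) → Prop
  | none, some i => 0 < G.b i
  | some l, some i => 0 < G.a i l
  | _, none => False

/-- The graph has a directed spanning tree rooted at the leader: every follower is reached from
the leader along directed edges. -/
def HasLeaderSpanningTree : Prop := ∀ i, Relation.ReflTransGen G.Edge none (some i)

/-- `g_i = ∑_l a_il + b_i`. -/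
def g (i : Fin N) : ℝ := ∑ l, G.a i l + G.b i

/-- The graph Laplacian of the followers. -/
def laplacian : Matrix (Fin N) (Fin N) ℝ :=
  Matrix.diagonal (fun i => ∑ l, G.a i l) - Matrix.of G.a

/-- `L + B`. -/
def Ltilde : Matrix (Fin N) (Fin N) ℝ := G.laplacian + Matrix.diagonal G.b

end Topology

/-! ### Agents -/

/-- Drifts, disturbances and leader input of `n`-th order strict-feedback agents; the drift of
layer `k` is a function of the first `k` states (the layers are numbered from `0` here). -/
structure Plant (N n : ℕ) where
  f₀ : ∀ k : Fin n, (Fin (k + 1) → ℝ) → ℝ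
  f : Fin N → ∀ k : Fin n, (Fin (k + 1) → ℝ) → ℝ
  d₀ : Fin n → ℝ → ℝ
  d : Fin N → Fin n → ℝ → ℝ
  u₀ : ℝ → ℝ

/-- Constants bounding the uncertainties: `dBar` bounds the disturbances and `ddBar` their time
derivatives (index `₀`: leader), `deltaBar` the squared approximation errors of the estimator
networks, `lamS` the largest eigenvalue of `S Sᵀ` for the actor-critic activations `S`. -/
structure Bounds (N n : ℕ) where
  dBar₀ : Fin n → ℝ
  ddBar₀ : Fin n → ℝ
  dBar : Fin N → Fin n → ℝ
  ddBar : Fin N → Fin n → ℝ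
  deltaBar : Fin N → Fin n → ℝ
  lamS : Fin N → Fin n → ℝ

/-- The bounds on disturbances are positive, those on errors nonnegative. -/
structure Bounds.Valid {N n : ℕ} (U : Bounds N n) : Prop where
  dBar₀_pos : ∀ k, 0 < U.dBar₀ k
  ddBar₀_pos : ∀ k, 0 < U.ddBar₀ k
  dBar_pos : ∀ i k, 0 < U.dBar i k
  ddBar_pos : ∀ i k, 0 < U.ddBar i k
  deltaBar_nonneg : ∀ i k, 0 ≤ U.deltaBar i k
  lamS_nonneg : ∀ i k, 0 ≤ U.lamS i k

/-- The drifts are smooth, and the disturbances are differentiable for `t ≥ 0` and bounded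
together with their derivatives. -/
structure Plant.Standing {N n : ℕ} (P : Plant N n) (U : Bounds N n) : Prop where
  smooth₀ : ∀ k, ContDiff ℝ ∞ (P.f₀ k)
  smooth : ∀ i k, ContDiff ℝ ∞ (P.f i k)
  diff₀ : ∀ k, DifferentiableOn ℝ (P.d₀ k) (Set.Ici 0)
  diff : ∀ i k, DifferentiableOn ℝ (P.d i k) (Set.Ici 0)
  bound₀ : ∀ k, ∀ t ≥ 0, |P.d₀ k t| < U.dBar₀ k
  bound : ∀ i k, ∀ t ≥ 0, |P.d i k t| < U.dBar i k
  derivBound₀ : ∀ k, ∀ t ≥ 0, |derivWithin (P.d₀ k) (Set.Ici 0) t| < U.ddBar₀ k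
  derivBound : ∀ i k, ∀ t ≥ 0, |derivWithin (P.d i k) (Set.Ici 0) t| < U.ddBar i k

/-! ### Controller parameters and networks

`mS i k` is the number of neurons of the actor and critic networks, and `mF i k` the one of the
estimator network, of layer `k` of follower `i`. -/

/-- The input of the estimator network of layer `k` of follower `i`: the first states
`x_i1, …, x_ik` and the weights and disturbance estimates of all previous layers. -/
structure EstimatorInput {N n : ℕ} (mS mF : Fin N → Fin n → ℕ) (i : Fin N) (k : Fin n) where
  x : Fin (k + 1) → ℝ
  Wc : ∀ l : Fin k, Fin (mS i (l.castLE k.2.le)) → ℝ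
  Wa : ∀ l : Fin k, Fin (mS i (l.castLE k.2.le)) → ℝ
  θ : ∀ l : Fin k, Fin (mF i (l.castLE k.2.le)) → ℝ
  dh : Fin k → ℝ

/-- Activation functions: `S` of the actor and critic networks, `Φ` of the estimators. -/
structure Networks {N n : ℕ} (mS mF : Fin N → Fin n → ℕ) where
  S : ∀ i k, ℝ → Fin (mS i k) → ℝ
  Φ : ∀ i k, EstimatorInput mS mF i k → Fin (mF i k) → ℝ

/-- Ideal (unknown, constant) weights of the actor-critic and of the estimator networks. -/
structure IdealWeights {N n : ℕ} (mS mF : Fin N → Fin n → ℕ) where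
  W : ∀ i k, Fin (mS i k) → ℝ
  θ : ∀ i k, Fin (mF i k) → ℝ

/-- Control gains `k, k_p, k_q` and adaptation gains `γ, Γ_c, Γ_a, Γ_θ`. -/
structure Gains {N n : ℕ} (mS mF : Fin N → Fin n → ℕ) where
  k : Fin N → Fin n → ℝ
  kp : Fin N → Fin n → ℝ
  kq : Fin N → Fin n → ℝ
  γ : Fin N → Fin n → ℝ
  Γc : ∀ i j, Matrix (Fin (mS i j)) (Fin (mS i j)) ℝ
  Γa : ∀ i j, Matrix (Fin (mS i j)) (Fin (mS i j)) ℝ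
  Γθ : ∀ i j, Matrix (Fin (mF i j)) (Fin (mF i j)) ℝ

/-- The parameter conditions on the gains. -/
structure Gains.Admissible {N n : ℕ} {mS mF : Fin N → Fin n → ℕ} (K : Gains mS mF) : Prop where
  k_gt : ∀ i j, 3 / 2 < K.k i j
  kp_pos : ∀ i j, 0 < K.kp i j
  kq_pos : ∀ i j, 0 < K.kq i j
  γ_pos : ∀ i j, 0 < K.γ i j
  Γc_pos : ∀ i j, (K.Γc i j).PosDef
  Γa_pos : ∀ i j, (K.Γa i j).PosDef
  Γθ_pos : ∀ i j, (K.Γθ i j).PosDef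

/-- All gains that tune the ultimate bound are at least `R`. -/
structure Gains.AtLeast {N n : ℕ} {mS mF : Fin N → Fin n → ℕ} (K : Gains mS mF) (R : ℝ) :
    Prop where
  kp_ge : ∀ i j, R ≤ K.kp i j
  kq_ge : ∀ i j, R ≤ K.kq i j
  γ_ge : ∀ i j, R ≤ K.γ i j
  Γc_ge : ∀ i j, (K.Γc i j - R • 1).PosSemidef
  Γa_ge : ∀ i j, (K.Γa i j - R • 1).PosSemidef
  Γθ_ge : ∀ i j, (K.Γθ i j - R • 1).PosSemidef

/-- Coefficients `σ` of the adaptation laws, and the constant `μ` of the parameter condition on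
the disturbance estimators. -/
structure Coeffs (N n : ℕ) where
  σ1c : Fin N → Fin n → ℝ
  σ2c : Fin N → Fin n → ℝ
  σ3c : Fin N → Fin n → ℝ
  σ1a : Fin N → Fin n → ℝ
  σ2a : Fin N → Fin n → ℝ
  σ3a : Fin N → Fin n → ℝ
  σ1θ : Fin N → Fin n → ℝ
  σ2θ : Fin N → Fin n → ℝ
  σ1d : Fin N → Fin n → ℝ
  σ2d : Fin N → Fin n → ℝ
  μ : Fin N → Fin n → ℝ

/-- The parameter conditions on the coefficients of the adaptation laws. -/
structure Coeffs.Admissible {N n : ℕ} (c : Coeffs N n) : Prop where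
  actor1 : ∀ i k, 1 < c.σ1a i k
  critic1 : ∀ i k, c.σ1a i k < c.σ1c i k
  actor2 : ∀ i k, 0 < c.σ2a i k
  critic2 : ∀ i k, 2 * c.σ2a i k < c.σ2c i k
  actor3 : ∀ i k, 0 < c.σ3a i k
  critic3 : ∀ i k, c.σ3a i k < c.σ3c i k / (8 * 172)
  est1 : ∀ i k, 0 < c.σ1θ i k
  est2 : ∀ i k, 0 < c.σ2θ i k
  dist1 : ∀ i k, 0 < c.σ1d i k
  μ_pos : ∀ i k, 0 < c.μ i k
  dist2 : ∀ i k, 2 / c.μ i k ^ 4 < c.σ2d i k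

/-! ### Closed loop -/

/-- The signals of the closed loop as functions of time: states `x₀` of the leader and `x` of
the followers, controls `α` (virtual controls, and the actual input at the last layer), critic
and actor weights `Wc, Wa`, estimator weights `θ` and disturbance estimates `dh`. -/
structure Signals {N n : ℕ} (mS mF : Fin N → Fin n → ℕ) where
  x₀ : Fin n → ℝ → ℝ
  x : Fin N → Fin n → ℝ → ℝ
  α : Fin N → Fin n → ℝ → ℝ
  Wc : ∀ i k, ℝ → Fin (mS i k) → ℝ
  Wa : ∀ i k, ℝ → Fin (mS i k) → ℝ
  θ : ∀ i k, ℝ → Fin (mF i k) → ℝ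
  dh : Fin N → Fin n → ℝ → ℝ

section Loop

variable {N n : ℕ} {mS mF : Fin N → Fin n → ℕ}

namespace Signals

/-- The tracking errors `y_i - y_0`. -/
def trackErr [NeZero n] (s : Signals mS mF) (t : ℝ) : Fin N → ℝ :=
  fun i => s.x i 0 t - s.x₀ 0 t

/-- The consensus errors `∑_l a_il (y_i - y_l) + b_i (y_i - y_0)`. -/
def consErr [NeZero n] (s : Signals mS mF) (G : Topology N) (t : ℝ) : Fin N → ℝ :=
  fun i => ∑ l, G.a i l * (s.x i 0 t - s.x l 0 t) + G.b i * (s.x i 0 t - s.x₀ 0 t)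

/-- The error of backstepping layer `k`: the consensus error for the first layer, and the
virtual error `x_ik - α_i(k-1)` for the later ones. -/
def stepErr [NeZero n] (s : Signals mS mF) (G : Topology N) (i : Fin N) (k : Fin n) (t : ℝ) :
    ℝ :=
  if (k : ℕ) = 0 then s.consErr G t i
  else s.x i k t - s.α i ⟨k - 1, lt_of_le_of_lt (Nat.sub_le _ _) k.2⟩ t

/-- The backstepping term of layer `k`: absent in the first layer, `g_i e_i` in the second, and
the virtual error of the previous layer in the later ones. -/
def prevErr [NeZero n] (s : Signals mS mF) (G : Topology N) (i : Fin N) (k : Fin n) (t : ℝ) :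
    ℝ :=
  if (k : ℕ) = 0 then 0
  else (if (k : ℕ) = 1 then G.g i else 1) *
    s.stepErr G i ⟨k - 1, lt_of_le_of_lt (Nat.sub_le _ _) k.2⟩ t

/-- What drives layer `k` of the leader: the next state, and the input at the last layer. -/
def next₀ (s : Signals mS mF) (P : Plant N n) (k : Fin n) (t : ℝ) : ℝ :=
  if h : (k : ℕ) + 1 < n then s.x₀ ⟨k + 1, h⟩ t else P.u₀ t

/-- What drives layer `k` of follower `i`: the next state, and the input `u_i = α_in` at the
last layer. -/
def next (s : Signals mS mF) (i : Fin N) (k : Fin n) (t : ℝ) : ℝ :=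
  if h : (k : ℕ) + 1 < n then s.x i ⟨k + 1, h⟩ t else s.α i k t

/-- The first states of the leader, up to layer `k`. -/
def bar₀ (s : Signals mS mF) (k : Fin n) (t : ℝ) : Fin (k + 1) → ℝ :=
  fun l => s.x₀ (l.castLE k.2) t

/-- The first states of follower `i`, up to layer `k`. -/
def bar (s : Signals mS mF) (i : Fin N) (k : Fin n) (t : ℝ) : Fin (k + 1) → ℝ :=
  fun l => s.x i (l.castLE k.2) t

/-- The input of the estimator network at time `t`. -/
def estInput (s : Signals mS mF) (i : Fin N) (k : Fin n) (t : ℝ) :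
    EstimatorInput mS mF i k where
  x := s.bar i k t
  Wc := fun l => s.Wc i (l.castLE k.2.le) t
  Wa := fun l => s.Wa i (l.castLE k.2.le) t
  θ := fun l => s.θ i (l.castLE k.2.le) t
  dh := fun l => s.dh i (l.castLE k.2.le) t

/-- The approximate optimal control `-(k ζ + Waᵀ S(ζ)) / g` of a layer with error `ζ`; the
factor `g` is `g_i` in the first layer and `1` in the later ones. -/
def vHat [NeZero n] (s : Signals mS mF) (G : Topology N) (A : Networks mS mF) (K : Gains mS mF)
    (i : Fin N) (k : Fin n) (t : ℝ) : ℝ :=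
  (-(K.k i k * s.stepErr G i k t) - s.Wa i k t ⬝ᵥ A.S i k (s.stepErr G i k t)) /
    (if (k : ℕ) = 0 then G.g i else 1)

/-- The fixed-time part of the control of a layer. -/
def hFix [NeZero n] (s : Signals mS mF) (G : Topology N) (A : Networks mS mF) (K : Gains mS mF)
    (i : Fin N) (k : Fin n) (t : ℝ) : ℝ :=
  (-(K.kp i k * oddPow p (s.stepErr G i k t)) - K.kq i k * oddPow q (s.stepErr G i k t)
      - s.θ i k t ⬝ᵥ A.Φ i k (s.estInput i k t) - s.dh i k t - s.prevErr G i k t) /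
    (if (k : ℕ) = 0 then G.g i else 1)

/-- The unknown term `F` that the estimator network of a layer approximates. -/
def unknownTerm [NeZero n] (s : Signals mS mF) (G : Topology N) (P : Plant N n)
    (i : Fin N) (k : Fin n) (t : ℝ) : ℝ :=
  if (k : ℕ) = 0 then
    G.g i * P.f i k (s.bar i k t) - ∑ l, G.a i l * (s.next l k t + P.f l k (s.bar l k t))
      - G.b i * (s.next₀ P k t + P.f₀ k (s.bar₀ k t))
  else
    P.f i k (s.bar i k t)
      - derivWithin (s.α i ⟨k - 1, lt_of_le_of_lt (Nat.sub_le _ _) k.2⟩) (Set.Ici 0) t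

end Signals

/-- `s` is a solution on `[0, ∞)` of the leader and follower dynamics in closed loop with the
controller and its adaptation laws. -/
structure IsClosedLoop [NeZero n] (G : Topology N) (P : Plant N n) (A : Networks mS mF)
    (K : Gains mS mF) (c : Coeffs N n) (s : Signals mS mF) : Prop where
  leader : ∀ k, ∀ t ≥ 0, HasDerivWithinAt (s.x₀ k)
    (s.next₀ P k t + P.f₀ k (s.bar₀ k t) + P.d₀ k t) (Set.Ici 0) t
  follower : ∀ i k, ∀ t ≥ 0, HasDerivWithinAt (s.x i k)
    (s.next i k t + P.f i k (s.bar i k t) + P.d i k t) (Set.Ici 0) t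
  control : ∀ i k, ∀ t ≥ 0, s.α i k t = s.vHat G A K i k t + s.hFix G A K i k t
  critic : ∀ i k, ∀ t ≥ 0, HasDerivWithinAt (s.Wc i k)
    (K.Γc i k *ᵥ (-(s.stepErr G i k t • A.S i k (s.stepErr G i k t))
      - c.σ1c i k • (Matrix.vecMulVec (A.S i k (s.stepErr G i k t))
          (A.S i k (s.stepErr G i k t)) *ᵥ s.Wc i k t)
      - c.σ2c i k • oddPowVec p (s.Wc i k t)
      - c.σ3c i k • oddPowVec q (s.Wc i k t))) (Set.Ici 0) t
  actor : ∀ i k, ∀ t ≥ 0, HasDerivWithinAt (s.Wa i k)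
    (K.Γa i k *ᵥ (-(c.σ1a i k • (Matrix.vecMulVec (A.S i k (s.stepErr G i k t))
          (A.S i k (s.stepErr G i k t)) *ᵥ (s.Wa i k t - s.Wc i k t)))
      - c.σ2a i k • oddPowVec p (s.Wa i k t - s.Wc i k t)
      - c.σ3a i k • oddPowVec q (s.Wa i k t - s.Wc i k t))) (Set.Ici 0) t
  estimator : ∀ i k, ∀ t ≥ 0, HasDerivWithinAt (s.θ i k)
    (K.Γθ i k *ᵥ (s.stepErr G i k t • A.Φ i k (s.estInput i k t)
      - c.σ1θ i k • oddPowVec p (s.θ i k t)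
      - c.σ2θ i k • oddPowVec q (s.θ i k t))) (Set.Ici 0) t
  disturbance : ∀ i k, ∀ t ≥ 0, HasDerivWithinAt (s.dh i k)
    (K.γ i k * (s.stepErr G i k t - c.σ1d i k * oddPow p (s.dh i k t)
      - c.σ2d i k * oddPow q (s.dh i k t))) (Set.Ici 0) t

/-- The estimator networks with ideal weights approximate the unknown terms along `s` with
squared error at most `deltaBar`. The unknown terms of the later layers contain the time
derivatives of the virtual controls, which therefore exist. -/
structure ApproximatesAlong [NeZero n] (G : Topology N) (P : Plant N n) (A : Networks mS mF)
    (I : IdealWeights mS mF) (U : Bounds N n) (s : Signals mS mF) : Prop where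
  diff : ∀ i (k : Fin n), (k : ℕ) + 1 < n → DifferentiableOn ℝ (s.α i k) (Set.Ici 0)
  err : ∀ i k, ∀ t ≥ 0,
    (s.unknownTerm G P i k t - I.θ i k ⬝ᵥ A.Φ i k (s.estInput i k t)) ^ 2 ≤ U.deltaBar i k

/-! ### Explicit constants -/

/-- Bound of the disturbance that layer `k` of follower `i` estimates: in the first layer, it is
`g_i d_i1 - ∑ a_il d_l1 - b_i d_01`. -/
def distBound (G : Topology N) (U : Bounds N n) (i : Fin N) (k : Fin n) : ℝ :=
  if (k : ℕ) = 0 then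
    G.g i * U.dBar i k + ∑ l, G.a i l * U.dBar l k + G.b i * U.dBar₀ k
  else U.dBar i k

/-- Bound of the time derivative of the same disturbance. -/
def distDerivBound (G : Topology N) (U : Bounds N n) (i : Fin N) (k : Fin n) : ℝ :=
  if (k : ℕ) = 0 then
    G.g i * U.ddBar i k + ∑ l, G.a i l * U.ddBar l k + G.b i * U.ddBar₀ k
  else U.ddBar i k

/-- The constant `C_ik` of layer `k` of follower `i`. -/
def layerConst (G : Topology N) (I : IdealWeights mS mF) (U : Bounds N n) (K : Gains mS mF)
    (c : Coeffs N n) (i : Fin N) (k : Fin n) : ℝ :=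
  U.deltaBar i k / 2
    + c.σ1c i k / 2 * U.lamS i k * (I.W i k ⬝ᵥ I.W i k)
    + c.σ2c i k * powSum (p + 1) (I.W i k)
    + 172 * c.σ3c i k * powSum (q + 1) (I.W i k)
    + c.σ1θ i k * powSum (p + 1) (I.θ i k)
    + 172 * c.σ2θ i k * powSum (q + 1) (I.θ i k)
    + c.σ1d i k * distBound G U i k ^ (p + 1)
    + 172 * c.σ2d i k * distBound G U i k ^ (q + 1)
    + 3 / 4 * (c.μ i k / K.γ i k) ^ (4 / 3 : ℝ) * distDerivBound G U i k ^ (4 / 3 : ℝ)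

/-- `C = ∑ C_ik`. -/
def totalConst (G : Topology N) (I : IdealWeights mS mF) (U : Bounds N n) (K : Gains mS mF)
    (c : Coeffs N n) : ℝ :=
  ∑ i, ∑ k, layerConst G I U K c i k

/-- Minimum of a quantity over all layers of all followers. -/
def layerMin (F : Fin N → Fin n → ℝ) : ℝ := ⨅ ik : Fin N × Fin n, F ik.1 ik.2

/-- Maximum of a quantity over all layers of all followers. -/
def layerMax (F : Fin N → Fin n → ℝ) : ℝ := ⨆ ik : Fin N × Fin n, F ik.1 ik.2

/-- The decay rate of the `(p + 1) / 2` power of the Lyapunov function: the minimum of the rates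
of the errors, the critic weights, the actor weights, the estimator weights and the disturbance
estimates. -/
def rateP (K : Gains mS mF) (c : Coeffs N n) : ℝ :=
  min (2 ^ pLyap * layerMin K.kp) <|
  min ((2 / layerMax fun i k => lamMax (K.Γc i k)⁻¹) ^ pLyap *
    layerMin fun i k => c.σ2c i k / 2 - c.σ2a i k) <|
  min (1 / 2 * (2 / layerMax fun i k => lamMax (K.Γa i k)⁻¹) ^ pLyap * layerMin c.σ2a) <|
  min (1 / 2 * (2 / layerMax fun i k => lamMax (K.Γθ i k)⁻¹) ^ pLyap * layerMin c.σ1θ)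
    (1 / 2 * (2 * layerMin K.γ) ^ pLyap * layerMin c.σ1d)

/-- Number of scalar errors, `n N`. -/
def numLayers (N n : ℕ) : ℝ := (n : ℝ) * N

/-- Total number of neurons. -/
def numNeurons (m : Fin N → Fin n → ℕ) : ℝ := ∑ i, ∑ k, (m i k : ℝ)

/-- The decay rate of the `(q + 1) / 2` power of the Lyapunov function, which is a sum of five
parts (errors, critic weights, actor weights, estimator weights, disturbance estimates). -/
def rateQ (K : Gains mS mF) (c : Coeffs N n) : ℝ :=
  (5 : ℝ) ^ (1 - qLyap) *
  (min (2 ^ qLyap * numLayers N n ^ (1 - qLyap) * layerMin K.kq) <|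
  min ((2 / layerMax fun i k => lamMax (K.Γc i k)⁻¹) ^ qLyap * numNeurons mS ^ (1 - qLyap) *
    layerMin fun i k => c.σ3c i k / 8 - 172 * c.σ3a i k) <|
  min ((2 / layerMax fun i k => lamMax (K.Γa i k)⁻¹) ^ qLyap * numNeurons mS ^ (1 - qLyap) *
    layerMin fun i k => c.σ3a i k / 8) <|
  min ((2 / layerMax fun i k => lamMax (K.Γθ i k)⁻¹) ^ qLyap * numNeurons mF ^ (1 - qLyap) *
    layerMin fun i k => c.σ2θ i k / 8)
    ((2 * layerMin K.γ) ^ qLyap * numLayers N n ^ (1 - qLyap) *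
      layerMin fun i k => c.σ2d i k / 8 - 1 / (4 * c.μ i k ^ 4)))

/-- The settling-time bound `1 / (k_p (1 - p)) + 1 / (k_q (q - 1))` with the rates and exponents
of the Lyapunov function. It depends on controller parameters only. -/
def Tmax (K : Gains mS mF) (c : Coeffs N n) : ℝ :=
  1 / (rateP K c * (1 - pLyap)) + 1 / (rateQ K c * (qLyap - 1))

/-- The ultimate bound of the consensus error. -/
def radiusE (G : Topology N) (I : IdealWeights mS mF) (U : Bounds N n) (K : Gains mS mF)
    (c : Coeffs N n) (ϑ : ℝ) : ℝ :=
  √(2 * min ((totalConst G I U K c / ((1 - ϑ) * rateP K c)) ^ (1 / pLyap))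
    ((totalConst G I U K c / ((1 - ϑ) * rateQ K c)) ^ (1 / qLyap)))

/-- The ultimate bound of the tracking error. -/
def radiusZ (G : Topology N) (I : IdealWeights mS mF) (U : Bounds N n) (K : Gains mS mF)
    (c : Coeffs N n) (ϑ : ℝ) : ℝ :=
  radiusE G I U K c ϑ / singMin G.Ltilde

end Loop

end FixedTimeConsensus

end

/-!
The proof is a Lyapunov argument. The function `lyapunov` sums `ζ² / 2` over all layer errors `ζ`,
the energies `½ w̃ᵀ Γ⁻¹ w̃` of the errors `w̃` of all critic, actor and estimator weights, and the
energies `d̃² / (2 γ)` of the errors of the disturbance estimates. Along the closed loop, the terms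
that couple consecutive layers cancel (`sum_coupling_eq_zero`); the estimation errors enter the
dynamics of `ζ` in the way that the adaptation laws compensate; and the terms of the actor and the
critic that are quadratic in `ζ`, `w̃ᵀ S` and `W*ᵀ S` form a sum of squares up to the part of the
constant `C` that comes from `W*` (`actorCritic_bound`). The odd powers of the estimates are
coercive in the estimation errors up to powers of the ideal values (`oddPow_p_coercive`,
`oddPow_q_coercive`); these are the remaining parts of `C`. Subadditivity of the power `2 / 3` and
the Cauchy–Schwarz inequality turn the sums of `4 / 3` and fourth powers that remain into powers of
the Lyapunov function (`rate_mul_lyapunov_le`), so that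
`V' ≤ -k_p V ^ (2 / 3) - k_q V ^ 2 + C`.

Above the threshold in the ultimate bound, `C` is absorbed and the decay is at least
`ϑ (k_p V ^ (2 / 3) + k_q V ^ 2)`. In a rescaled variable `w` proportional to `V ^ (1 / 3)`, the
primitive of `1 / (1 + w ^ 4)` then decreases at a constant rate. Its total variation is
`π / (2 √2)`, and this is enough below `4 / 3` for the threshold to be reached before
`17 / 20 * Tmax / ϑ` (`decay_time_lt`); this single time gives both bounds on the settling time.
The sublevel set is never left again (`fixedTime_bound`).

The tracking errors `z` satisfy `e = (L + B) z`. A maximum principle along the paths from the leader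
(`Topology.eq_zero_of_Ltilde_mulVec`) shows that `L + B` is injective and, for undirected graphs,
that its eigenvalues are positive, so that neither quotient in the bounds is a division by zero.
For the adjustable radius, `k_p` grows like the power `2 / 3` of the gains (`exists_rateP_ge`),
while `C` stays bounded (`totalConst_le`).
-/

namespace FixedTimeConsensus

/-! ### Scalar inequalities for odd powers -/

lemma p_add_one : p + 1 = 4 / 3 := by norm_num [p]

lemma pLyap_eq : pLyap = 2 / 3 := by norm_num [pLyap, p]

lemma qLyap_eq : qLyap = 2 := by norm_num [qLyap, q]

lemma abs_rpow_q_add_one (x : ℝ) : |x| ^ (q + 1) = x ^ 4 := by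
  rw [show q + 1 = ((4 : ℕ) : ℝ) by norm_num [q], Real.rpow_natCast]
  exact Even.pow_abs (by decide) x

lemma oddPow_q (x : ℝ) : oddPow q x = x ^ 3 := by
  unfold oddPow
  rw [show q = ((3 : ℕ) : ℝ) by norm_num [q], Real.rpow_natCast]
  rcases lt_trichotomy x 0 with h | h | h
  · rw [Real.sign_of_neg h, abs_of_neg h]; ring
  · simp [h]
  · rw [Real.sign_of_pos h, abs_of_pos h]; ring

/-- The odd power `p` is the real cube root; in terms of it, `|x| ^ (p + 1)` is a polynomial. -/
lemma exists_oddPow_p (x : ℝ) : ∃ y, y ^ 3 = x ∧ oddPow p x = y ∧ |x| ^ (p + 1) = y ^ 4 := by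
  have h3 : (|x| ^ p) ^ 3 = |x| := by
    rw [← Real.rpow_natCast, ← Real.rpow_mul (abs_nonneg x)]
    norm_num [p]
  have h4 : |x| ^ (p + 1) = (|x| ^ p) ^ 4 := by
    rw [← Real.rpow_natCast, ← Real.rpow_mul (abs_nonneg x)]
    norm_num [p]
  refine ⟨oddPow p x, ?_, rfl, ?_⟩
  · rcases lt_trichotomy x 0 with h | h | h
    · rw [oddPow, Real.sign_of_neg h, mul_pow, h3, abs_of_neg h]; ring
    · simp [h, oddPow]
    · rw [oddPow, Real.sign_of_pos h, mul_pow, h3, abs_of_pos h]; ring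
  · rw [h4]
    rcases lt_trichotomy x 0 with h | h | h
    · rw [oddPow, Real.sign_of_neg h]; ring
    · simp [h, oddPow, p]
    · rw [oddPow, Real.sign_of_pos h]; ring

lemma mul_oddPow_p (x : ℝ) : x * oddPow p x = |x| ^ (p + 1) := by
  obtain ⟨y, h1, h2, h3⟩ := exists_oddPow_p x
  rw [h2, h3, ← h1]; ring

/-- `oddPow_p_coercive` in terms of the cube roots `X, Y, Z` of `x, y, x - y`, for `x ≥ 0`. -/
lemma cubeRoot_ineq_of_nonneg {X Y Z : ℝ} (hX : 0 ≤ X) (h : X ^ 3 = Y ^ 3 + Z ^ 3) :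
    X ^ 4 / 2 - Y ^ 4 ≤ X ^ 3 * Z := by
  have hX3 : 0 ≤ X ^ 3 := by positivity
  -- Either `Z` is at least `X / 2`, or `Y` is so close to `X` or beyond that `Y ^ 4` dominates.
  rcases le_or_gt (X / 2) Z with hZ | hZ
  · nlinarith [mul_le_mul_of_nonneg_left hZ hX3, sq_nonneg (Y ^ 2)]
  rcases le_or_gt 0 Z with hZ0 | hZ0
  · have hXp : 0 < X := by linarith
    have hZ3 : Z ^ 3 ≤ (X / 2) ^ 3 := by gcongr
    have hY : 7 / 8 * X ≤ Y := by
      by_contra! hlt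
      have h1 : Y ^ 3 < (7 / 8 * X) ^ 3 := Odd.strictMono_pow (by decide) hlt
      have h2 : 0 < X ^ 3 := by positivity
      nlinarith
    have hY4 : (7 / 8 * X) ^ 4 ≤ Y ^ 4 := by gcongr
    have : 0 ≤ X ^ 3 * Z := by positivity
    nlinarith [pow_pos hXp 4]
  · have hYX : X ≤ Y := by
      by_contra! hlt
      have h1 : Y ^ 3 < X ^ 3 := Odd.strictMono_pow (by decide) hlt
      have h2 : Z ^ 3 < 0 := Odd.pow_neg (by decide) hZ0
      linarith
    obtain ⟨z, rfl⟩ : ∃ z, Z = -z := ⟨-Z, by ring⟩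
    have hz : 0 < z := by linarith
    have hYz : z ≤ Y := by
      by_contra! hlt
      have h1 : Y ^ 3 < z ^ 3 := Odd.strictMono_pow (by decide) hlt
      nlinarith
    have hY4 : Y ^ 4 = Y * X ^ 3 + Y * z ^ 3 := by linear_combination -Y * h
    have hz3 : 0 < z ^ 3 := by positivity
    have hY0 : 0 ≤ Y := hX.trans hYX
    rcases le_or_gt X z with hzX | hzX
    · have h1 : z * X ^ 3 ≤ Y * X ^ 3 := by gcongr
      have h2 : X * X ^ 3 ≤ Y * z ^ 3 := by gcongr
      nlinarith [sq_nonneg (X ^ 2)]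
    · have h1 : X * X ^ 3 ≤ Y * X ^ 3 := by gcongr
      have h2 : X * z ^ 3 ≤ Y * z ^ 3 := by gcongr
      have h3 : 0 ≤ X * (X ^ 3 / 2 + z ^ 3 - X ^ 2 * z) := by
        refine mul_nonneg hX ?_
        nlinarith [mul_nonneg hX (sq_nonneg (X - 7 / 4 * z)),
          mul_nonneg hz.le (sq_nonneg (X - 7 / 4 * z)), sq_nonneg (X - z),
          mul_nonneg hX (sq_nonneg (X - z)), mul_nonneg hz.le (sq_nonneg (X - z)),
          mul_nonneg hz.le (sq_nonneg (2 * X - 3 * z))]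
      nlinarith

/-- Perturbed coercivity of the odd power `p`: the shift `y` costs half of the leading term. -/
lemma oddPow_p_coercive (x y : ℝ) :
    |x| ^ (p + 1) / 2 - |y| ^ (p + 1) ≤ x * oddPow p (x - y) := by
  obtain ⟨X, hX, -, hX4⟩ := exists_oddPow_p x
  obtain ⟨Y, hY, -, hY4⟩ := exists_oddPow_p y
  obtain ⟨Z, hZ, hZ1, -⟩ := exists_oddPow_p (x - y)
  rw [hX4, hY4, hZ1, ← hX]
  have h : X ^ 3 = Y ^ 3 + Z ^ 3 := by linarith
  rcases le_total 0 X with h0 | h0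
  · exact cubeRoot_ineq_of_nonneg h0 h
  · have := cubeRoot_ineq_of_nonneg (X := -X) (Y := -Y) (Z := -Z) (by linarith)
      (by linear_combination -h)
    nlinarith

/-- Perturbed coercivity of the odd power `q`. -/
lemma oddPow_q_coercive (x y : ℝ) : x ^ 4 / 8 - 172 * y ^ 4 ≤ x * oddPow q (x - y) := by
  rw [oddPow_q]
  nlinarith [sq_nonneg (x ^ 2 - 12 / 7 * x * y - 3 * y ^ 2), sq_nonneg (x * y), sq_nonneg (y ^ 2),
    sq_nonneg (x * y - y ^ 2), sq_nonneg (x * y + y ^ 2)]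

/-- Young's inequality with exponents `4` and `4 / 3`. -/
lemma young_four (a b : ℝ) : a * b ≤ a ^ 4 / 4 + 3 / 4 * |b| ^ (4 / 3 : ℝ) := by
  obtain ⟨B, hB, -, hB4⟩ := exists_oddPow_p b
  rw [← p_add_one, hB4, ← hB]
  nlinarith [sq_nonneg (a ^ 2 - B ^ 2), sq_nonneg (a * B - B ^ 2), sq_nonneg (a - B),
    mul_nonneg (sq_nonneg (a - B)) (sq_nonneg (a + B)),
    mul_nonneg (sq_nonneg (a - B)) (sq_nonneg B), mul_nonneg (sq_nonneg (a - B)) (sq_nonneg a)]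

/-! ### Fixed-time convergence -/

/-- The primitive of `1 / (1 + u ^ 4)` that vanishes at `0`. -/
noncomputable def quarticPrimitive (u : ℝ) : ℝ :=
  √2 / 8 * (Real.log (u ^ 2 + √2 * u + 1) - Real.log (u ^ 2 - √2 * u + 1)) +
    √2 / 4 * (Real.arctan (√2 * u + 1) + Real.arctan (√2 * u - 1))

lemma quadratic_add_pos (u : ℝ) : 0 < u ^ 2 + √2 * u + 1 := by
  nlinarith [Real.sq_sqrt (show (0 : ℝ) ≤ 2 by norm_num), sq_nonneg (u + √2 / 2)]

lemma quadratic_sub_pos (u : ℝ) : 0 < u ^ 2 - √2 * u + 1 := by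
  nlinarith [Real.sq_sqrt (show (0 : ℝ) ≤ 2 by norm_num), sq_nonneg (u - √2 / 2)]

lemma hasDerivAt_quarticPrimitive (u : ℝ) :
    HasDerivAt quarticPrimitive (1 / (1 + u ^ 4)) u := by
  have hs : √2 ^ 2 = 2 := Real.sq_sqrt (by norm_num)
  have hA := quadratic_add_pos u
  have hB := quadratic_sub_pos u
  have dA : HasDerivAt (fun u : ℝ => u ^ 2 + √2 * u + 1) (2 * u + √2) u := by
    simpa using ((hasDerivAt_pow 2 u).add ((hasDerivAt_id u).const_mul √2)).add_const 1
  have dB : HasDerivAt (fun u : ℝ => u ^ 2 - √2 * u + 1) (2 * u - √2) u := by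
    simpa using ((hasDerivAt_pow 2 u).sub ((hasDerivAt_id u).const_mul √2)).add_const 1
  have d1 : HasDerivAt (fun u : ℝ => √2 * u + 1) √2 u := by
    simpa using ((hasDerivAt_id u).const_mul √2).add_const 1
  have d2 : HasDerivAt (fun u : ℝ => √2 * u - 1) √2 u := by
    simpa using ((hasDerivAt_id u).const_mul √2).sub_const 1
  refine ((((dA.log hA.ne').sub (dB.log hB.ne')).const_mul (√2 / 8)).add
    ((d1.arctan.add d2.arctan).const_mul (√2 / 4))).congr_deriv ?_
  have e1 : 1 + (√2 * u + 1) ^ 2 = 2 * (u ^ 2 + √2 * u + 1) := by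
    linear_combination u ^ 2 * hs
  have e2 : 1 + (√2 * u - 1) ^ 2 = 2 * (u ^ 2 - √2 * u + 1) := by
    linear_combination u ^ 2 * hs
  have e3 : 1 + u ^ 4 = (u ^ 2 + √2 * u + 1) * (u ^ 2 - √2 * u + 1) := by
    linear_combination u ^ 2 * hs
  rw [e1, e2, e3]
  obtain ⟨A, hAe⟩ : ∃ A, A = u ^ 2 + √2 * u + 1 := ⟨_, rfl⟩
  obtain ⟨B, hBe⟩ : ∃ B, B = u ^ 2 - √2 * u + 1 := ⟨_, rfl⟩
  rw [← hAe] at hA ⊢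
  rw [← hBe] at hB ⊢
  field_simp
  rw [hAe, hBe]
  linear_combination 32 * hs

lemma monotone_quarticPrimitive : Monotone quarticPrimitive :=
  monotone_of_hasDerivAt_nonneg hasDerivAt_quarticPrimitive fun u => by
    simp only [Pi.zero_apply]; positivity

lemma quarticPrimitive_nonneg {u : ℝ} (hu : 0 ≤ u) : 0 ≤ quarticPrimitive u := by
  have h0 : quarticPrimitive 0 = 0 := by simp [quarticPrimitive, Real.arctan_neg]
  exact h0 ▸ monotone_quarticPrimitive hu

lemma sqrt_two_lt : √2 < 1.4143 := by
  rw [Real.sqrt_lt' (by norm_num)]; norm_num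

/-- The integral of `1 / (1 + u ^ 4)` over the half line is `π / (2 √2) = 1.1107…`. -/
lemma quarticPrimitive_lt (u : ℝ) : quarticPrimitive u < 1.13 := by
  -- By monotonicity `u` may be taken large, so that the logarithms nearly cancel.
  refine (monotone_quarticPrimitive (le_max_left u 100)).trans_lt ?_
  have hv : (100 : ℝ) ≤ max u 100 := le_max_right _ _
  generalize max u 100 = v at hv
  have hs : √2 ^ 2 = 2 := Real.sq_sqrt (by norm_num)
  have hs1 := sqrt_two_lt
  have hs0 : 0 < √2 := by positivity
  have hA := quadratic_add_pos v
  have hB := quadratic_sub_pos v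
  have hlog : Real.log (v ^ 2 + √2 * v + 1) - Real.log (v ^ 2 - √2 * v + 1) ≤
      2 * √2 * v / (v ^ 2 - √2 * v + 1) := by
    rw [← Real.log_div hA.ne' hB.ne']
    refine (Real.log_le_sub_one_of_pos (by positivity)).trans_eq ?_
    rw [div_sub_one hB.ne']
    ring
  have hlog2 : √2 / 8 * (2 * √2 * v / (v ^ 2 - √2 * v + 1)) ≤ 0.01 := by
    rw [← mul_div_assoc, div_le_iff₀ hB]
    nlinarith
  have hlog3 := mul_le_mul_of_nonneg_left hlog (by positivity : 0 ≤ √2 / 8)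
  have h1 := Real.arctan_lt_pi_div_two (√2 * v + 1)
  have h2 := Real.arctan_lt_pi_div_two (√2 * v - 1)
  have h3 : √2 / 4 * (Real.arctan (√2 * v + 1) + Real.arctan (√2 * v - 1)) ≤ √2 / 4 * Real.pi := by
    gcongr; linarith
  have h4 : √2 / 4 * Real.pi ≤ 1.4143 / 4 * 3.1416 := by
    have := Real.pi_lt_d4
    have := Real.pi_pos
    gcongr
  unfold quarticPrimitive
  norm_num at hlog2 h4 ⊢
  linarith

/-- While `V` stays positive and decays at least at rate `a V ^ (2 / 3) + b V ^ 2`, less time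
passes than `17 / 20` of `3 / a + 1 / b`. In the variable `w = (b / a) ^ (1 / 4) V ^ (1 / 3)` the
decay of `quarticPrimitive w` is uniform, and `4 (a / b) ^ (1 / 4) ≤ 3 + a / b`. -/
lemma decay_time_lt {V V' : ℝ → ℝ} {a b t : ℝ} (ha : 0 < a) (hb : 0 < b) (ht : 0 ≤ t)
    (hV : ∀ s ≥ 0, HasDerivWithinAt V (V' s) (Set.Ici 0) s)
    (hpos : ∀ s ∈ Set.Icc 0 t, 0 < V s)
    (hdec : ∀ s ∈ Set.Icc 0 t, V' s ≤ -(a * V s ^ (2 / 3 : ℝ) + b * V s ^ 2)) :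
    t < 17 / 20 * (3 / a + 1 / b) := by
  set c : ℝ := (a / b) ^ (1 / 4 : ℝ) with hc
  have hc0 : 0 < c := by positivity
  have hc4 : c ^ 4 = a / b := by
    rw [hc, ← Real.rpow_natCast, ← Real.rpow_mul (by positivity)]; norm_num
  set f : ℝ → ℝ := fun s => quarticPrimitive (V s ^ (1 / 3 : ℝ) / c) + a / (3 * c) * s with hf
  set f' : ℝ → ℝ := fun s => 1 / (1 + (V s ^ (1 / 3 : ℝ) / c) ^ 4) *
      (V' s * (1 / 3) * V s ^ ((1 / 3 : ℝ) - 1) / c) + a / (3 * c) with hf'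
  have hd : ∀ s ∈ Set.Icc 0 t, HasDerivWithinAt f (f' s) (Set.Ici 0) s := by
    intro s hs
    have h1 : HasDerivWithinAt (fun s => V s ^ (1 / 3 : ℝ) / c)
        (V' s * (1 / 3) * V s ^ ((1 / 3 : ℝ) - 1) / c) (Set.Ici 0) s :=
      ((hV s hs.1).rpow_const (Or.inl (hpos s hs).ne')).div_const c
    have h2 := (hasDerivAt_quarticPrimitive (V s ^ (1 / 3 : ℝ) / c)).comp_hasDerivWithinAt s h1
    have h3 := (hasDerivWithinAt_id s (Set.Ici 0)).const_mul (a / (3 * c))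
    exact (h2.add h3).congr_deriv (by simp [hf'])
  have hneg : ∀ s ∈ Set.Icc 0 t, f' s ≤ 0 := by
    intro s hs
    have hVs := hpos s hs
    obtain ⟨u, hu, hu0⟩ : ∃ u, V s ^ (1 / 3 : ℝ) = u ∧ 0 < u := ⟨_, rfl, by positivity⟩
    have hu3 : V s = u ^ 3 := by
      rw [← hu, ← Real.rpow_natCast, ← Real.rpow_mul hVs.le]; norm_num
    have hu2 : V s ^ (2 / 3 : ℝ) = u ^ 2 := by
      rw [← hu, ← Real.rpow_natCast, ← Real.rpow_mul hVs.le]; norm_num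
    have hum : V s ^ ((1 / 3 : ℝ) - 1) = (u ^ 2)⁻¹ := by
      rw [← hu2, ← Real.rpow_neg hVs.le]; norm_num
    have h := hdec s hs
    rw [hu2, hu3] at h
    have hb' : b = a / c ^ 4 := by rw [hc4]; field_simp
    simp only [hf', hu, hum]
    have key : V' s * (1 / 3) * (u ^ 2)⁻¹ / c ≤ -(a / (3 * c)) * (1 + (u / c) ^ 4) := by
      calc V' s * (1 / 3) * (u ^ 2)⁻¹ / c
          ≤ -(a * u ^ 2 + b * (u ^ 3) ^ 2) * (1 / 3) * (u ^ 2)⁻¹ / c := by gcongr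
        _ = -(a / (3 * c)) * (1 + (u / c) ^ 4) := by rw [hb']; field_simp
    have hden : 0 < 1 + (u / c) ^ 4 := by positivity
    calc 1 / (1 + (u / c) ^ 4) * (V' s * (1 / 3) * (u ^ 2)⁻¹ / c) + a / (3 * c)
        ≤ 1 / (1 + (u / c) ^ 4) * (-(a / (3 * c)) * (1 + (u / c) ^ 4)) + a / (3 * c) := by gcongr
      _ = 0 := by field_simp; ring
  have hanti : AntitoneOn f (Set.Icc 0 t) := by
    refine antitoneOn_of_hasDerivWithinAt_nonpos (f' := f') (convex_Icc 0 t)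
      (fun s hs => ((hd s hs).mono Set.Icc_subset_Ici_self).continuousWithinAt) ?_ ?_
    · intro s hs
      exact (hd s (interior_subset hs)).mono (interior_subset.trans Set.Icc_subset_Ici_self)
    · exact fun s hs => hneg s (interior_subset hs)
  have hend := hanti (Set.left_mem_Icc.2 ht) (Set.right_mem_Icc.2 ht) ht
  have hlow : 0 ≤ quarticPrimitive (V t ^ (1 / 3 : ℝ) / c) :=
    quarticPrimitive_nonneg (by have := hpos t (Set.right_mem_Icc.2 ht); positivity)
  have hup := quarticPrimitive_lt (V 0 ^ (1 / 3 : ℝ) / c)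
  have h1 : a / (3 * c) * t < 1.13 := by
    simp only [hf, mul_zero, add_zero] at hend
    linarith
  have h2 : t < 1.13 * (3 * c) / a := by
    rw [lt_div_iff₀ ha]
    rw [div_mul_eq_mul_div, div_lt_iff₀ (by positivity)] at h1
    linarith
  have h3 : 17 / 20 * (3 / a + 1 / b) = 17 / 20 * (3 + c ^ 4) / a := by
    rw [hc4]; field_simp
  rw [h3]
  refine h2.trans_le (div_le_div_of_nonneg_right ?_ ha.le)
  nlinarith [sq_nonneg (c ^ 2 - 1), sq_nonneg (c - 1)]

/-- A nonnegative function with `V' ≤ -a V ^ (2 / 3) - b V ^ 2 + C` is at most the smaller of the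
two thresholds at which one of the decay terms alone, up to the fraction `ϑ`, dominates `C`, from
a time on that does not depend on `V 0`. -/
lemma fixedTime_bound {V V' : ℝ → ℝ} {a b C ϑ : ℝ} (ha : 0 < a) (hb : 0 < b) (hC : 0 < C)
    (hϑ₀ : 0 < ϑ) (hϑ₁ : ϑ < 1)
    (hV : ∀ s ≥ 0, HasDerivWithinAt V (V' s) (Set.Ici 0) s)
    (hdec : ∀ s ≥ 0, V' s ≤ -(a * V s ^ (2 / 3 : ℝ) + b * V s ^ 2) + C)
    {t : ℝ} (ht : 17 / 20 * (3 / a + 1 / b) / ϑ ≤ t) :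
    V t ≤ min ((C / ((1 - ϑ) * a)) ^ (3 / 2 : ℝ)) ((C / ((1 - ϑ) * b)) ^ (1 / 2 : ℝ)) := by
  have h1ϑ : 0 < 1 - ϑ := by linarith
  set R := min ((C / ((1 - ϑ) * a)) ^ (3 / 2 : ℝ)) ((C / ((1 - ϑ) * b)) ^ (1 / 2 : ℝ)) with hR
  have hR0 : 0 < R := lt_min (by positivity) (by positivity)
  have ht0 : 0 ≤ t := le_trans (by positivity) ht
  -- Above the threshold the constant is absorbed by a part of the decay.
  have habs : ∀ s ≥ 0, R ≤ V s → V' s ≤ -(ϑ * a * V s ^ (2 / 3 : ℝ) + ϑ * b * V s ^ 2) := by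
    intro s hs hRs
    have hVs : 0 < V s := hR0.trans_le hRs
    have hp : 0 ≤ (1 - ϑ) * a * V s ^ (2 / 3 : ℝ) := by positivity
    have hq : 0 ≤ (1 - ϑ) * b * V s ^ 2 := by positivity
    have h := hdec s hs
    rcases min_le_iff.1 hRs with h1 | h1
    · have h2 := Real.rpow_le_rpow (by positivity) h1 (by norm_num : (0 : ℝ) ≤ 2 / 3)
      rw [← Real.rpow_mul (by positivity), show (3 / 2 : ℝ) * (2 / 3) = 1 by norm_num,
        Real.rpow_one, div_le_iff₀ (by positivity)] at h2
      nlinarith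
    · have h2 := pow_le_pow_left₀ (by positivity) h1 2
      rw [← Real.rpow_natCast, ← Real.rpow_mul (by positivity),
        show (1 / 2 : ℝ) * ((2 : ℕ) : ℝ) = 1 by norm_num,
        Real.rpow_one, div_le_iff₀ (by positivity)] at h2
      nlinarith
  by_contra! hlt
  have hcont : ContinuousOn V (Set.Ici 0) := fun s hs => (hV s hs).continuousWithinAt
  -- The sublevel set of `R` cannot be left again, so `V` exceeds `R` on all of `[0, t]`.
  have habove : ∀ s ∈ Set.Icc 0 t, R < V s := by
    intro s₀ hs₀
    by_contra! hle
    set A := Set.Icc s₀ t ∩ V ⁻¹' Set.Iic R with hA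
    have hcontA : ContinuousOn V (Set.Icc s₀ t) :=
      hcont.mono fun x hx => hs₀.1.trans hx.1
    have hcl : IsClosed A := hcontA.preimage_isClosed_of_isClosed isClosed_Icc isClosed_Iic
    have hne : A.Nonempty := ⟨s₀, ⟨le_rfl, hs₀.2⟩, hle⟩
    have hbdd : BddAbove A := ⟨t, fun x hx => hx.1.2⟩
    obtain ⟨⟨h1, h2⟩, h3⟩ := hcl.csSup_mem hne hbdd
    set m := sSup A
    have h0m : 0 ≤ m := hs₀.1.trans h1
    have hout : ∀ x ∈ Set.Ioo m t, R < V x := by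
      intro x hx
      by_contra! hxR
      exact absurd (le_csSup hbdd ⟨⟨h1.trans hx.1.le, hx.2.le⟩, hxR⟩) (not_le.2 hx.1)
    have hanti : AntitoneOn V (Set.Icc m t) := by
      have hsub : Set.Icc m t ⊆ Set.Ici 0 := fun x hx => h0m.trans hx.1
      refine antitoneOn_of_hasDerivWithinAt_nonpos (f' := V') (convex_Icc m t)
        (hcont.mono hsub) ?_ ?_
      · exact fun x hx => (hV x (hsub (interior_subset hx))).mono (interior_subset.trans hsub)
      · intro x hx
        rw [interior_Icc] at hx
        have hx0 : 0 ≤ x := h0m.trans hx.1.le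
        have hVx : 0 < V x := hR0.trans (hout x hx)
        refine (habs x hx0 (hout x hx).le).trans ?_
        have : 0 ≤ ϑ * a * V x ^ (2 / 3 : ℝ) + ϑ * b * V x ^ 2 := by positivity
        linarith
    have := hanti (Set.left_mem_Icc.2 h2) (Set.right_mem_Icc.2 h2) h2
    have h3' : V m ≤ R := h3
    linarith
  have := decay_time_lt (mul_pos hϑ₀ ha) (mul_pos hϑ₀ hb) ht0 hV
    (fun s hs => hR0.trans (habove s hs)) (fun s hs => habs s hs.1 (habove s hs).le)
  have heq : 17 / 20 * (3 / (ϑ * a) + 1 / (ϑ * b)) = 17 / 20 * (3 / a + 1 / b) / ϑ := by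
    field_simp
  linarith

/-! ### Extreme eigenvalues of symmetric matrices -/

section Matrices

variable {m : ℕ} {M : Matrix (Fin m) (Fin m) ℝ}

lemma mem_spectrum_iff_exists_mulVec {r : ℝ} :
    r ∈ spectrum ℝ M ↔ ∃ v, v ≠ 0 ∧ M *ᵥ v = r • v := by
  rw [← Matrix.spectrum_toLin', ← Module.End.hasEigenvalue_iff_mem_spectrum]
  constructor
  · intro h
    obtain ⟨v, hv⟩ := h.exists_hasEigenvector
    exact ⟨v, hv.2, by simpa using hv.apply_eq_smul⟩
  · rintro ⟨v, hv0, hv⟩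
    exact Module.End.hasEigenvalue_of_hasEigenvector
      ⟨Module.End.mem_eigenspace_iff.2 (by simpa using hv), hv0⟩

lemma finite_spectrum (hM : M.IsHermitian) : (spectrum ℝ M).Finite := by
  rw [hM.spectrum_real_eq_range_eigenvalues]; exact Set.finite_range _

lemma nonempty_spectrum (hM : M.IsHermitian) (hm : 0 < m) : (spectrum ℝ M).Nonempty := by
  have : Nonempty (Fin m) := ⟨⟨0, hm⟩⟩
  rw [hM.spectrum_real_eq_range_eigenvalues]; exact Set.range_nonempty _

lemma lamMin_mem_spectrum (hM : M.IsHermitian) (hm : 0 < m) : lamMin M ∈ spectrum ℝ M :=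
  (nonempty_spectrum hM hm).csInf_mem (finite_spectrum hM)

lemma lamMax_mem_spectrum (hM : M.IsHermitian) (hm : 0 < m) : lamMax M ∈ spectrum ℝ M :=
  (nonempty_spectrum hM hm).csSup_mem (finite_spectrum hM)

lemma posSemidef_of_spectrum_nonneg (hM : M.IsHermitian) (h : ∀ r ∈ spectrum ℝ M, 0 ≤ r) :
    M.PosSemidef := by
  rw [hM.posSemidef_iff_eigenvalues_nonneg]
  intro i
  exact h _ (hM.spectrum_real_eq_range_eigenvalues ▸ Set.mem_range_self i)

lemma isHermitian_smul_one (r : ℝ) : (r • (1 : Matrix (Fin m) (Fin m) ℝ)).IsHermitian := by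
  simp [Matrix.IsHermitian]

lemma dotProduct_mulVec_le_lamMax (hM : M.IsHermitian) (v : Fin m → ℝ) :
    v ⬝ᵥ M *ᵥ v ≤ lamMax M * (v ⬝ᵥ v) := by
  have hps : (lamMax M • (1 : Matrix (Fin m) (Fin m) ℝ) - M).PosSemidef := by
    refine posSemidef_of_spectrum_nonneg ((isHermitian_smul_one _).sub hM) fun r hr => ?_
    obtain ⟨w, hw0, hw⟩ := mem_spectrum_iff_exists_mulVec.1 hr
    have hmem : lamMax M - r ∈ spectrum ℝ M := by
      refine mem_spectrum_iff_exists_mulVec.2 ⟨w, hw0, ?_⟩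
      rw [Matrix.sub_mulVec, Matrix.smul_mulVec, Matrix.one_mulVec] at hw
      rw [sub_smul, ← hw]; abel
    have := le_csSup (finite_spectrum hM).bddAbove hmem
    unfold lamMax at *
    linarith
  have h := hps.dotProduct_mulVec_nonneg v
  rw [Matrix.sub_mulVec, Matrix.smul_mulVec, Matrix.one_mulVec, dotProduct_sub,
    dotProduct_smul] at h
  simpa using h

lemma lamMin_le_dotProduct_mulVec (hM : M.IsHermitian) (v : Fin m → ℝ) :
    lamMin M * (v ⬝ᵥ v) ≤ v ⬝ᵥ M *ᵥ v := by
  have hps : (M - lamMin M • (1 : Matrix (Fin m) (Fin m) ℝ)).PosSemidef := by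
    refine posSemidef_of_spectrum_nonneg (hM.sub (isHermitian_smul_one _)) fun r hr => ?_
    obtain ⟨w, hw0, hw⟩ := mem_spectrum_iff_exists_mulVec.1 hr
    have hmem : lamMin M + r ∈ spectrum ℝ M := by
      refine mem_spectrum_iff_exists_mulVec.2 ⟨w, hw0, ?_⟩
      rw [Matrix.sub_mulVec, Matrix.smul_mulVec, Matrix.one_mulVec] at hw
      rw [add_smul, ← hw]; abel
    have := csInf_le (finite_spectrum hM).bddBelow hmem
    unfold lamMin at *
    linarith
  have h := hps.dotProduct_mulVec_nonneg v
  rw [Matrix.sub_mulVec, Matrix.smul_mulVec, Matrix.one_mulVec, dotProduct_sub,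
    dotProduct_smul] at h
  simpa using h

lemma dotProduct_self_nonneg (v : Fin m → ℝ) : 0 ≤ v ⬝ᵥ v :=
  Finset.sum_nonneg fun _ _ => mul_self_nonneg _

lemma dotProduct_self_pos {v : Fin m → ℝ} (hv : v ≠ 0) : 0 < v ⬝ᵥ v := by
  simpa using Matrix.dotProduct_star_self_pos_iff.2 hv

lemma lamMax_inv_pos (hM : M.PosDef) (hm : 0 < m) : 0 < lamMax M⁻¹ := by
  obtain ⟨v, hv0, hv⟩ := mem_spectrum_iff_exists_mulVec.1
    (lamMax_mem_spectrum hM.inv.isHermitian hm)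
  have h1 : 0 < v ⬝ᵥ M⁻¹ *ᵥ v := by simpa using hM.inv.dotProduct_mulVec_pos hv0
  rw [hv, dotProduct_smul, smul_eq_mul] at h1
  exact (pos_iff_pos_of_mul_pos h1).2 (dotProduct_self_pos hv0)

lemma inv_mulVec_mulVec (hM : M.PosDef) (v : Fin m → ℝ) : M⁻¹ *ᵥ (M *ᵥ v) = v := by
  rw [Matrix.mulVec_mulVec, Matrix.nonsing_inv_mul _ ((Matrix.isUnit_iff_isUnit_det M).1 hM.isUnit),
    Matrix.one_mulVec]

lemma mulVec_inv_mulVec (hM : M.PosDef) (v : Fin m → ℝ) : M *ᵥ (M⁻¹ *ᵥ v) = v := by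
  rw [Matrix.mulVec_mulVec, Matrix.mul_nonsing_inv _ ((Matrix.isUnit_iff_isUnit_det M).1 hM.isUnit),
    Matrix.one_mulVec]

lemma lamMax_inv_le (hM : M.PosDef) (hm : 0 < m) {R : ℝ} (hR : 0 < R)
    (h : (M - R • 1).PosSemidef) : lamMax M⁻¹ ≤ 1 / R := by
  obtain ⟨v, hv0, hv⟩ := mem_spectrum_iff_exists_mulVec.1
    (lamMax_mem_spectrum hM.inv.isHermitian hm)
  have hpos := lamMax_inv_pos hM hm
  have h1 := h.dotProduct_mulVec_nonneg v
  rw [Matrix.sub_mulVec, Matrix.smul_mulVec, Matrix.one_mulVec, dotProduct_sub,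
    dotProduct_smul] at h1
  have hvec : v = lamMax M⁻¹ • M *ᵥ v := by
    rw [← Matrix.mulVec_smul, ← hv, mulVec_inv_mulVec hM]
  have h2 : v ⬝ᵥ v = lamMax M⁻¹ * (v ⬝ᵥ M *ᵥ v) := by
    rw [← smul_eq_mul, ← dotProduct_smul, ← hvec]
  have h3 := dotProduct_self_pos hv0
  simp at h1
  rw [le_div_iff₀ hR]
  have h4 : lamMax M⁻¹ * (R * (v ⬝ᵥ v)) ≤ v ⬝ᵥ v := by
    conv_rhs => rw [h2]
    exact mul_le_mul_of_nonneg_left h1 hpos.le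
  nlinarith

lemma eucl_eq (v : Fin m → ℝ) : eucl v = √(v ⬝ᵥ v) := by
  simp [eucl, dotProduct, sq]

lemma isHermitian_transpose_mul (M : Matrix (Fin m) (Fin m) ℝ) : (Mᵀ * M).IsHermitian := by
  simp [Matrix.IsHermitian, Matrix.conjTranspose_eq_transpose_of_trivial]

lemma singMin_pos (hm : 0 < m) (hinj : ∀ v, M *ᵥ v = 0 → v = 0) : 0 < singMin M := by
  have hH := isHermitian_transpose_mul M
  obtain ⟨v, hv0, hv⟩ := mem_spectrum_iff_exists_mulVec.1 (lamMin_mem_spectrum hH hm)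
  have h1 : v ⬝ᵥ (Mᵀ * M) *ᵥ v = (M *ᵥ v) ⬝ᵥ (M *ᵥ v) := by
    rw [← Matrix.mulVec_mulVec, Matrix.dotProduct_mulVec, Matrix.vecMul_transpose]
  have h2 : 0 < (M *ᵥ v) ⬝ᵥ (M *ᵥ v) := dotProduct_self_pos fun h => hv0 (hinj v h)
  rw [hv, dotProduct_smul, smul_eq_mul] at h1
  rw [← h1] at h2
  exact Real.sqrt_pos.2 ((pos_iff_pos_of_mul_pos h2).2 (dotProduct_self_pos hv0))

lemma eucl_le_div_singMin (h : 0 < singMin M) (v : Fin m → ℝ) :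
    eucl v ≤ eucl (M *ᵥ v) / singMin M := by
  have hH := isHermitian_transpose_mul M
  have h1 := lamMin_le_dotProduct_mulVec hH v
  rw [← Matrix.mulVec_mulVec, Matrix.dotProduct_mulVec, Matrix.vecMul_transpose] at h1
  rw [le_div_iff₀ h, eucl_eq, eucl_eq, singMin, ← Real.sqrt_mul (dotProduct_self_nonneg v)]
  exact Real.sqrt_le_sqrt (by linarith)

lemma eucl_le_div_lamMin (hM : M.IsHermitian) (h : 0 < lamMin M) (v : Fin m → ℝ) :
    eucl v ≤ eucl (M *ᵥ v) / lamMin M := by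
  have h1 := lamMin_le_dotProduct_mulVec hM v
  have h2 : v ⬝ᵥ M *ᵥ v ≤ eucl v * eucl (M *ᵥ v) := Real.sum_mul_le_sqrt_mul_sqrt _ _ _
  have h3 : v ⬝ᵥ v = eucl v * eucl v := by
    rw [eucl_eq, Real.mul_self_sqrt (dotProduct_self_nonneg v)]
  have h4 : 0 ≤ eucl v := Real.sqrt_nonneg _
  rw [le_div_iff₀ h]
  rcases h4.eq_or_lt with h0 | h0
  · rw [← h0, zero_mul]; exact Real.sqrt_nonneg _
  · refine le_of_mul_le_mul_left ?_ h0
    rw [h3] at h1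
    linarith

end Matrices

/-! ### The communication graph -/

namespace Topology

variable {N : ℕ} {G : Topology N}

lemma g_pos (hG : G.HasLeaderSpanningTree) (i : Fin N) : 0 < G.g i := by
  have hsum : 0 ≤ ∑ l, G.a i l := Finset.sum_nonneg fun l _ => G.a_nonneg i l
  obtain h | ⟨u, -, hu⟩ := (hG i).cases_tail
  · simp at h
  · rcases u with _ | l
    · have : 0 < G.b i := hu
      unfold g; linarith
    · have h1 : 0 < G.a i l := hu
      have h2 : G.a i l ≤ ∑ l, G.a i l :=
        Finset.single_le_sum (fun l _ => G.a_nonneg i l) (Finset.mem_univ l)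
      have := G.b_nonneg i
      unfold g; linarith

lemma Ltilde_mulVec (v : Fin N → ℝ) (i : Fin N) :
    (G.Ltilde *ᵥ v) i = G.g i * v i - ∑ l, G.a i l * v l := by
  simp only [Ltilde, laplacian, Matrix.add_mulVec, Matrix.sub_mulVec, Pi.add_apply, Pi.sub_apply,
    Matrix.mulVec_diagonal, g]
  simp only [Matrix.mulVec, dotProduct, Matrix.of_apply]
  ring

/-- Maximum principle: a maximal `|v i|` would spread backwards along the edges to a neighbour of
the leader, where the equation fails. The case `s = 0` is the injectivity of `L + B`, and `s > 0`
excludes the eigenvalue `-s`. -/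
lemma eq_zero_of_Ltilde_mulVec (hG : G.HasLeaderSpanningTree) {s : ℝ} (hs : 0 ≤ s)
    {v : Fin N → ℝ} (hv : G.Ltilde *ᵥ v = -s • v) : v = 0 := by
  by_contra hne
  obtain ⟨j, hj⟩ : ∃ j, v j ≠ 0 := by
    by_contra! h; exact hne (funext h)
  have : Nonempty (Fin N) := ⟨j⟩
  obtain ⟨i₀, hi₀⟩ := Finite.exists_max fun i => |v i|
  set m := |v i₀| with hm
  have hm0 : 0 < m := (abs_pos.2 hj).trans_le (hi₀ j)
  have heq : ∀ i, (G.g i + s) * |v i| ≤ ∑ l, G.a i l * |v l| := by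
    intro i
    have h1 := congrFun hv i
    rw [Ltilde_mulVec, Pi.smul_apply, smul_eq_mul] at h1
    have h2 : (G.g i + s) * v i = ∑ l, G.a i l * v l := by linarith
    have h3 : 0 ≤ G.g i + s := add_nonneg (g_pos hG i).le hs
    calc (G.g i + s) * |v i| = |(G.g i + s) * v i| := by rw [abs_mul, abs_of_nonneg h3]
      _ = |∑ l, G.a i l * v l| := by rw [h2]
      _ ≤ ∑ l, |G.a i l * v l| := Finset.abs_sum_le_sum_abs _ _
      _ = _ := by simp_rw [abs_mul, abs_of_nonneg (G.a_nonneg _ _)]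
  have hlt : ∀ i, (0 < G.b i ∨ ∃ l, 0 < G.a i l ∧ |v l| < m) → |v i| < m := by
    intro i hi
    refine (hi₀ i).lt_of_ne fun hmax => ?_
    have h1 := heq i
    rw [hmax] at h1
    have h2 : ∑ l, G.a i l * |v l| ≤ ∑ l, G.a i l * m :=
      Finset.sum_le_sum fun l _ => mul_le_mul_of_nonneg_left (hi₀ l) (G.a_nonneg i l)
    have h3 : (G.g i + s) * m = ∑ l, G.a i l * m + (G.b i + s) * m := by
      rw [← Finset.sum_mul, g]; ring
    have hb := G.b_nonneg i
    rcases hi with hi | ⟨l, hl, hvl⟩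
    · have : 0 < (G.b i + s) * m := by positivity
      linarith
    · have h4 : ∑ l, G.a i l * |v l| < ∑ l, G.a i l * m :=
        Finset.sum_lt_sum (fun l _ => mul_le_mul_of_nonneg_left (hi₀ l) (G.a_nonneg i l))
          ⟨l, Finset.mem_univ l, mul_lt_mul_of_pos_left hvl hl⟩
      have : 0 ≤ (G.b i + s) * m := by positivity
      linarith
  have hall : ∀ u, Relation.ReflTransGen G.Edge none u → ∀ i, u = some i → |v i| < m := by
    intro u hu
    induction hu with
    | refl => intro i hi; simp at hi
    | @tail u w _ huw ih =>
      rintro i rfl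
      rcases u with _ | l
      · exact hlt i (Or.inl huw)
      · exact hlt i (Or.inr ⟨l, huw, ih l rfl⟩)
  exact (hall _ (hG i₀) i₀ rfl).ne rfl

lemma singMin_Ltilde_pos [NeZero N] (hG : G.HasLeaderSpanningTree) : 0 < singMin G.Ltilde :=
  singMin_pos (NeZero.pos N) fun v hv =>
    eq_zero_of_Ltilde_mulVec hG le_rfl (by simpa using hv)

lemma isHermitian_Ltilde (hsymm : ∀ i l, G.a i l = G.a l i) : G.Ltilde.IsHermitian := by
  have h : (Matrix.of G.a).IsHermitian := Matrix.IsHermitian.ext fun i l => by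
    simpa using hsymm l i
  exact ((Matrix.isHermitian_diagonal _).sub h).add (Matrix.isHermitian_diagonal _)

lemma lamMin_Ltilde_pos [NeZero N] (hG : G.HasLeaderSpanningTree)
    (hsymm : ∀ i l, G.a i l = G.a l i) : 0 < lamMin G.Ltilde := by
  obtain ⟨v, hv0, hv⟩ := mem_spectrum_iff_exists_mulVec.1
    (lamMin_mem_spectrum (isHermitian_Ltilde hsymm) (NeZero.pos N))
  by_contra! hle
  exact hv0 (eq_zero_of_Ltilde_mulVec hG (s := -lamMin G.Ltilde) (by linarith) (by simpa using hv))

end Topology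

lemma Signals.consErr_eq {N n : ℕ} [NeZero n] {mS mF : Fin N → Fin n → ℕ} (s : Signals mS mF)
    (G : Topology N) (t : ℝ) : s.consErr G t = G.Ltilde *ᵥ s.trackErr t := by
  funext i
  rw [Topology.Ltilde_mulVec, consErr, Topology.g, add_mul, Finset.sum_mul, add_sub_right_comm,
    ← Finset.sum_sub_distrib]
  simp only [trackErr]
  congr 1
  exact Finset.sum_congr rfl fun l _ => by ring

/-! ### Decay of the vector-valued errors -/

lemma powSum_neg {m : ℕ} (r : ℝ) (v : Fin m → ℝ) : powSum r (-v) = powSum r v := by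
  simp [powSum]

lemma powSum_nonneg {m : ℕ} (r : ℝ) (v : Fin m → ℝ) : 0 ≤ powSum r v :=
  Finset.sum_nonneg fun _ _ => by positivity

lemma oddPowVec_p_coercive {m : ℕ} (v w : Fin m → ℝ) :
    powSum (p + 1) v / 2 - powSum (p + 1) w ≤ v ⬝ᵥ oddPowVec p (v - w) := by
  rw [powSum, powSum, Finset.sum_div, ← Finset.sum_sub_distrib]
  exact Finset.sum_le_sum fun l _ => oddPow_p_coercive (v l) (w l)

lemma oddPowVec_q_coercive {m : ℕ} (v w : Fin m → ℝ) :
    powSum (q + 1) v / 8 - 172 * powSum (q + 1) w ≤ v ⬝ᵥ oddPowVec q (v - w) := by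
  rw [powSum, powSum, Finset.sum_div, Finset.mul_sum, ← Finset.sum_sub_distrib]
  refine Finset.sum_le_sum fun l _ => ?_
  rw [abs_rpow_q_add_one, abs_rpow_q_add_one]
  exact oddPow_q_coercive (v l) (w l)

lemma oddPowVec_p_coercive' {m : ℕ} (v w : Fin m → ℝ) :
    powSum (p + 1) (v - w) / 2 - powSum (p + 1) w ≤ (v - w) ⬝ᵥ oddPowVec p v := by
  simpa [powSum_neg] using oddPowVec_p_coercive (v - w) (-w)

lemma oddPowVec_q_coercive' {m : ℕ} (v w : Fin m → ℝ) :
    powSum (q + 1) (v - w) / 8 - 172 * powSum (q + 1) w ≤ (v - w) ⬝ᵥ oddPowVec q v := by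
  simpa [powSum_neg] using oddPowVec_q_coercive (v - w) (-w)

lemma dotProduct_vecMulVec_mulVec {m : ℕ} (v S w : Fin m → ℝ) :
    v ⬝ᵥ (Matrix.vecMulVec S S *ᵥ w) = (v ⬝ᵥ S) * (w ⬝ᵥ S) := by
  rw [Matrix.vecMulVec_mulVec, op_smul_eq_smul, dotProduct_smul, smul_eq_mul,
    dotProduct_comm S w, mul_comm]

/-- The actor and critic weight errors together with the actor's part of the control. The terms
that are quadratic in `z` and the projections on `S` form a sum of squares. -/
lemma actorCritic_bound {m : ℕ} {S Wc Wa W : Fin m → ℝ} {z lam σ1c σ2c σ3c σ1a σ2a σ3a : ℝ}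
    (hS : S ⬝ᵥ S ≤ lam) (h1a : 1 < σ1a) (h1c : σ1a < σ1c) (h2a : 0 < σ2a) (h2c : 2 * σ2a < σ2c)
    (h3a : 0 < σ3a) (h3c : σ3a < σ3c / (8 * 172)) :
    -(z * (Wa ⬝ᵥ S)) +
      (Wc - W) ⬝ᵥ (-(z • S) - σ1c • (Matrix.vecMulVec S S *ᵥ Wc) - σ2c • oddPowVec p Wc
        - σ3c • oddPowVec q Wc) +
      (Wa - W) ⬝ᵥ (-(σ1a • (Matrix.vecMulVec S S *ᵥ (Wa - Wc))) - σ2a • oddPowVec p (Wa - Wc)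
        - σ3a • oddPowVec q (Wa - Wc)) ≤
    z ^ 2 + (σ1c / 2 * lam * (W ⬝ᵥ W) + σ2c * powSum (p + 1) W + 172 * σ3c * powSum (q + 1) W)
      - ((σ2c / 2 - σ2a) * powSum (p + 1) (Wc - W)
        + (σ3c / 8 - 172 * σ3a) * powSum (q + 1) (Wc - W)
        + σ2a / 2 * powSum (p + 1) (Wa - W) + σ3a / 8 * powSum (q + 1) (Wa - W)) := by
  have hcp := mul_le_mul_of_nonneg_left (oddPowVec_p_coercive' Wc W) (by linarith : 0 ≤ σ2c)
  have hcq := mul_le_mul_of_nonneg_left (oddPowVec_q_coercive' Wc W) (by linarith : 0 ≤ σ3c)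
  have hap := mul_le_mul_of_nonneg_left (oddPowVec_p_coercive (Wa - W) (Wc - W)) h2a.le
  have haq := mul_le_mul_of_nonneg_left (oddPowVec_q_coercive (Wa - W) (Wc - W)) h3a.le
  rw [sub_sub_sub_cancel_right] at hap haq
  have hcs : (W ⬝ᵥ S) ^ 2 ≤ lam * (W ⬝ᵥ W) := by
    have h : (W ⬝ᵥ S) ^ 2 ≤ (W ⬝ᵥ W) * (S ⬝ᵥ S) := by
      simpa [dotProduct, sq] using Finset.sum_mul_sq_le_sq_mul_sq Finset.univ W S
    nlinarith [mul_le_mul_of_nonneg_left hS (dotProduct_self_nonneg W)]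
  have hw := mul_le_mul_of_nonneg_left hcs (by linarith : 0 ≤ σ1c / 2)
  simp only [dotProduct_sub, dotProduct_neg, dotProduct_smul, dotProduct_vecMulVec_mulVec,
    smul_eq_mul]
  simp only [sub_dotProduct] at *
  generalize Wc ⬝ᵥ S = a at *
  generalize Wa ⬝ᵥ S = b at *
  generalize W ⬝ᵥ S = w at *
  have key : -(z * b) - z * (a - w) - σ1c * ((a - w) * a) - σ1a * ((b - w) * (b - a)) ≤
      z ^ 2 + σ1c / 2 * w ^ 2 := by
    have e1 := mul_nonneg (by linarith : 0 ≤ σ1c - 1) (sq_nonneg a)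
    have e2 := mul_nonneg (by linarith : 0 ≤ σ1c - σ1a) (sq_nonneg (a - w))
    have e3 := mul_nonneg (by linarith : 0 ≤ σ1a) (sq_nonneg (b - a))
    have e4 := mul_nonneg (by linarith : 0 ≤ σ1a - 1) (sq_nonneg (b - w))
    nlinarith [sq_nonneg (b - w + z), sq_nonneg (a + z)]
  linarith

lemma estimator_bound {m : ℕ} {Φ θ θs : Fin m → ℝ} {z σ1 σ2 : ℝ} (h1 : 0 < σ1) (h2 : 0 < σ2) :
    z * (θs ⬝ᵥ Φ - θ ⬝ᵥ Φ) +
      (θ - θs) ⬝ᵥ (z • Φ - σ1 • oddPowVec p θ - σ2 • oddPowVec q θ) ≤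
    σ1 * powSum (p + 1) θs + 172 * σ2 * powSum (q + 1) θs
      - (σ1 / 2 * powSum (p + 1) (θ - θs) + σ2 / 8 * powSum (q + 1) (θ - θs)) := by
  have hp := mul_le_mul_of_nonneg_left (oddPowVec_p_coercive' θ θs) h1.le
  have hq := mul_le_mul_of_nonneg_left (oddPowVec_q_coercive' θ θs) h2.le
  simp only [dotProduct_sub, dotProduct_smul, smul_eq_mul]
  rw [sub_dotProduct θ θs Φ]
  linarith

lemma disturbance_bound {z D D' dh γ μ σ1 σ2 B B' : ℝ} (hγ : 0 < γ) (hμ : 0 < μ) (h1 : 0 < σ1)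
    (h2 : 0 < σ2) (hD : |D| ≤ B) (hD' : |D'| ≤ B') :
    z * (D - dh) + (dh - D) * (z - σ1 * oddPow p dh - σ2 * oddPow q dh) - (dh - D) * D' / γ ≤
    σ1 * B ^ (p + 1) + 172 * σ2 * B ^ (q + 1) + 3 / 4 * (μ / γ) ^ (4 / 3 : ℝ) * B' ^ (4 / 3 : ℝ)
      - (σ1 / 2 * |dh - D| ^ (p + 1) + (σ2 / 8 - 1 / (4 * μ ^ 4)) * (dh - D) ^ 4) := by
  have hp := oddPow_p_coercive (dh - D) (-D)
  have hq := oddPow_q_coercive (dh - D) (-D)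
  rw [sub_neg_eq_add, sub_add_cancel] at hp hq
  rw [abs_neg] at hp
  have hBp : |D| ^ (p + 1) ≤ B ^ (p + 1) :=
    Real.rpow_le_rpow (abs_nonneg _) hD (by norm_num [p])
  have hBq : (-D) ^ 4 ≤ B ^ (q + 1) := by
    rw [Even.neg_pow (by decide), ← abs_rpow_q_add_one]
    exact Real.rpow_le_rpow (abs_nonneg _) hD (by norm_num [q])
  have hB' : |D'| ^ (4 / 3 : ℝ) ≤ B' ^ (4 / 3 : ℝ) :=
    Real.rpow_le_rpow (abs_nonneg _) hD' (by norm_num)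
  have hy := young_four (-(dh - D) / μ) (μ / γ * D')
  have e1 : -(dh - D) / μ * (μ / γ * D') = -((dh - D) * D' / γ) := by field_simp
  have e2 : (-(dh - D) / μ) ^ 4 / 4 = 1 / (4 * μ ^ 4) * (dh - D) ^ 4 := by
    field_simp
  rw [e1, e2, abs_mul, abs_of_pos (by positivity : 0 < μ / γ),
    Real.mul_rpow (by positivity) (abs_nonneg _)] at hy
  have h3 := mul_le_mul_of_nonneg_left hB' (by positivity : 0 ≤ 3 / 4 * (μ / γ) ^ (4 / 3 : ℝ))
  have h4 := mul_le_mul_of_nonneg_left (hp.trans' (sub_le_sub_left hBp _)) h1.le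
  have h5 := mul_le_mul_of_nonneg_left
    (hq.trans' (sub_le_sub_left (mul_le_mul_of_nonneg_left hBq (by norm_num)) _)) h2.le
  nlinarith

/-! ### From sums of powers to powers of the energy -/

lemma rpow_sum_le_sum_rpow {ι : Type*} (s : Finset ι) {f : ι → ℝ} (hf : ∀ j, 0 ≤ f j) {r : ℝ}
    (h0 : 0 < r) (h1 : r ≤ 1) : (∑ j ∈ s, f j) ^ r ≤ ∑ j ∈ s, f j ^ r := by
  classical
  induction s using Finset.induction_on with
  | empty => simp [Real.zero_rpow h0.ne']
  | insert a s ha ih =>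
    rw [Finset.sum_insert ha, Finset.sum_insert ha]
    refine (Real.rpow_add_le_add_rpow (hf a) (Finset.sum_nonneg fun j _ => hf j) h0.le h1).trans ?_
    gcongr

/-- Energies `E j` dominated by the squares of vectors `v j` decay at the rate of the
`(p + 1)`-powers of their entries. -/
lemma energy_rpow_pLyap_le {ι : Type*} [Fintype ι] {m : ι → ℕ} (v : ∀ j, Fin (m j) → ℝ)
    {E coef : ι → ℝ} {a c : ℝ} (ha : 0 < a) (hE0 : ∀ j, 0 ≤ E j) (hE : ∀ j, a * E j ≤ v j ⬝ᵥ v j)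
    (hc0 : 0 ≤ c) (hc : ∀ j, c ≤ coef j) :
    a ^ pLyap * c * (∑ j, E j) ^ pLyap ≤ ∑ j, coef j * powSum (p + 1) (v j) := by
  have h0 : 0 < pLyap := by norm_num [pLyap_eq]
  have h1 : pLyap ≤ 1 := by norm_num [pLyap_eq]
  have hv : ∀ j, (a * E j) ^ pLyap ≤ powSum (p + 1) (v j) := by
    intro j
    refine (Real.rpow_le_rpow (mul_nonneg ha.le (hE0 j)) (hE j) h0.le).trans ?_
    refine (rpow_sum_le_sum_rpow _ (fun l => mul_self_nonneg _) h0 h1).trans_eq ?_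
    refine Finset.sum_congr rfl fun l _ => ?_
    rw [← abs_mul_abs_self, Real.mul_rpow (abs_nonneg _) (abs_nonneg _), pLyap_eq, p_add_one,
      show (4 / 3 : ℝ) = 2 / 3 + 2 / 3 by norm_num,
      Real.rpow_add_of_nonneg (abs_nonneg _) (by norm_num) (by norm_num)]
  calc a ^ pLyap * c * (∑ j, E j) ^ pLyap
      = c * (∑ j, a * E j) ^ pLyap := by
        rw [← Finset.mul_sum, Real.mul_rpow ha.le (Finset.sum_nonneg fun j _ => hE0 j)]; ring
    _ ≤ c * ∑ j, (a * E j) ^ pLyap := by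
        gcongr
        exact rpow_sum_le_sum_rpow _ (fun j => mul_nonneg ha.le (hE0 j)) h0 h1
    _ ≤ ∑ j, coef j * powSum (p + 1) (v j) := by
        rw [Finset.mul_sum]
        refine Finset.sum_le_sum fun j _ => ?_
        exact mul_le_mul (hc j) (hv j) (Real.rpow_nonneg (mul_nonneg ha.le (hE0 j)) _)
          (hc0.trans (hc j))

/-- The same for the `(q + 1)`-powers. By the Cauchy–Schwarz inequality, the square of a sum
costs the number of summands. -/
lemma energy_sq_le {ι : Type*} [Fintype ι] {m : ι → ℕ} (v : ∀ j, Fin (m j) → ℝ)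
    {E coef : ι → ℝ} {a c M : ℝ} (ha : 0 < a) (hE0 : ∀ j, 0 ≤ E j)
    (hE : ∀ j, a * E j ≤ v j ⬝ᵥ v j) (hc0 : 0 ≤ c) (hc : ∀ j, c ≤ coef j)
    (hM : M = ∑ j, (m j : ℝ)) (hM0 : 0 < M) :
    a ^ qLyap * M ^ (1 - qLyap) * c * (∑ j, E j) ^ 2 ≤ ∑ j, coef j * powSum (q + 1) (v j) := by
  have hpow : a ^ qLyap * M ^ (1 - qLyap) = a ^ 2 / M := by
    rw [qLyap_eq, Real.rpow_two, show (1 : ℝ) - 2 = -1 by norm_num, Real.rpow_neg_one,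
      div_eq_mul_inv]
  have hcs : (∑ j, v j ⬝ᵥ v j) ^ 2 ≤ M * ∑ j, powSum (q + 1) (v j) := by
    have h := sq_sum_le_card_mul_sum_sq (s := Finset.univ)
      (f := fun x : (Σ j, Fin (m j)) => v x.1 x.2 * v x.1 x.2)
    rw [Finset.card_univ, Fintype.card_sigma, Fintype.sum_sigma, Fintype.sum_sigma] at h
    simp only [Fintype.card_fin, Nat.cast_sum, ← hM] at h
    refine h.trans_eq ?_
    congr 1
    refine Finset.sum_congr rfl fun j _ => Finset.sum_congr rfl fun l _ => ?_
    rw [abs_rpow_q_add_one]; ring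
  have hsum0 : 0 ≤ ∑ j, E j := Finset.sum_nonneg fun j _ => hE0 j
  have hsq : (a * ∑ j, E j) ^ 2 ≤ M * ∑ j, powSum (q + 1) (v j) := by
    refine le_trans ?_ hcs
    rw [Finset.mul_sum]
    exact pow_le_pow_left₀ (Finset.sum_nonneg fun j _ => mul_nonneg ha.le (hE0 j))
      (Finset.sum_le_sum fun j _ => hE j) 2
  calc a ^ qLyap * M ^ (1 - qLyap) * c * (∑ j, E j) ^ 2
      = c * ((a * ∑ j, E j) ^ 2 / M) := by rw [hpow]; ring
    _ ≤ c * ∑ j, powSum (q + 1) (v j) := by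
        gcongr
        rw [div_le_iff₀ hM0]; linarith
    _ ≤ ∑ j, coef j * powSum (q + 1) (v j) := by
        rw [Finset.mul_sum]
        exact Finset.sum_le_sum fun j _ =>
          mul_le_mul_of_nonneg_right (hc j) (powSum_nonneg _ _)

lemma powSum_p_const (x : ℝ) : powSum (p + 1) (fun _ : Fin 1 => x) = |x| ^ (p + 1) := by
  simp [powSum]

lemma powSum_q_const (x : ℝ) : powSum (q + 1) (fun _ : Fin 1 => x) = x ^ 4 := by
  rw [← abs_rpow_q_add_one]; simp [powSum]

lemma rpow_pLyap_add_five_le {a b c d e : ℝ} (ha : 0 ≤ a) (hb : 0 ≤ b) (hc : 0 ≤ c) (hd : 0 ≤ d)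
    (he : 0 ≤ e) : (a + b + c + d + e) ^ pLyap ≤
      a ^ pLyap + b ^ pLyap + c ^ pLyap + d ^ pLyap + e ^ pLyap := by
  have h := rpow_sum_le_sum_rpow Finset.univ (f := ![a, b, c, d, e])
    (by intro j; fin_cases j <;> simpa) (r := pLyap) (by norm_num [pLyap_eq])
    (by norm_num [pLyap_eq])
  simpa [Fin.sum_univ_five] using h

lemma sq_add_five_le (a b c d e : ℝ) : (a + b + c + d + e) ^ 2 ≤
    5 * (a ^ 2 + b ^ 2 + c ^ 2 + d ^ 2 + e ^ 2) := by
  have h := sq_sum_le_card_mul_sum_sq (s := Finset.univ) (f := ![a, b, c, d, e])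
  simpa [Fin.sum_univ_five] using h

/-! ### Minima and maxima over the layers -/

section Layers

variable {N n : ℕ} {F : Fin N → Fin n → ℝ}

lemma layerMin_le (F : Fin N → Fin n → ℝ) (i : Fin N) (k : Fin n) : layerMin F ≤ F i k :=
  ciInf_le (Set.finite_range _).bddBelow (i, k)

lemma le_layerMax (F : Fin N → Fin n → ℝ) (i : Fin N) (k : Fin n) : F i k ≤ layerMax F :=
  le_ciSup (f := fun ik : Fin N × Fin n => F ik.1 ik.2) (Set.finite_range _).bddAbove (i, k)

variable [NeZero N] [NeZero n]

lemma le_layerMin {r : ℝ} (h : ∀ i k, r ≤ F i k) : r ≤ layerMin F :=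
  le_ciInf fun ik => h ik.1 ik.2

lemma layerMax_le {r : ℝ} (h : ∀ i k, F i k ≤ r) : layerMax F ≤ r :=
  ciSup_le fun ik => h ik.1 ik.2

lemma layerMin_pos (h : ∀ i k, 0 < F i k) : 0 < layerMin F := by
  obtain ⟨ik, hik⟩ := exists_eq_ciInf_of_finite (f := fun ik : Fin N × Fin n => F ik.1 ik.2)
  rw [layerMin, ← hik]
  exact h _ _

lemma layerMax_pos (h : ∀ i k, 0 < F i k) : 0 < layerMax F :=
  (h 0 0).trans_le (le_layerMax F 0 0)

end Layers

variable {N n : ℕ} {mS mF : Fin N → Fin n → ℕ}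

/-! ### Parameters -/

section Parameters

variable {c : Coeffs N n}

lemma Coeffs.Admissible.σ2d_pos (hc : c.Admissible) (i : Fin N) (k : Fin n) : 0 < c.σ2d i k :=
  lt_trans (by have := hc.μ_pos i k; positivity) (hc.dist2 i k)

lemma Coeffs.Admissible.critic_p_pos (hc : c.Admissible) (i : Fin N) (k : Fin n) :
    0 < c.σ2c i k / 2 - c.σ2a i k := by linarith [hc.critic2 i k]

lemma Coeffs.Admissible.critic_q_pos (hc : c.Admissible) (i : Fin N) (k : Fin n) :
    0 < c.σ3c i k / 8 - 172 * c.σ3a i k := by linarith [hc.critic3 i k]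

lemma Coeffs.Admissible.dist_q_pos (hc : c.Admissible) (i : Fin N) (k : Fin n) :
    0 < c.σ2d i k / 8 - 1 / (4 * c.μ i k ^ 4) := by
  have h := hc.dist2 i k
  have e : 1 / (4 * c.μ i k ^ 4) = 2 / c.μ i k ^ 4 / 8 := by
    rw [div_div, div_eq_div_iff (by have := hc.μ_pos i k; positivity)
      (by have := hc.μ_pos i k; positivity)]
    ring
  linarith

lemma numNeurons_eq (m : Fin N → Fin n → ℕ) :
    numNeurons m = ∑ j : Fin N × Fin n, (m j.1 j.2 : ℝ) := by
  rw [Fintype.sum_prod_type]; rfl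

lemma numLayers_eq : numLayers N n = ∑ _j : Fin N × Fin n, ((1 : ℕ) : ℝ) := by
  simp [numLayers, mul_comm]

end Parameters

/-! ### Error dynamics -/

/-- The factor `κ` of the control in the dynamics of the error of a layer. -/
noncomputable def inputGain (G : Topology N) (i : Fin N) (k : Fin n) : ℝ :=
  if (k : ℕ) = 0 then G.g i else 1

lemma inputGain_pos {G : Topology N} (hG : G.HasLeaderSpanningTree) (i : Fin N) (k : Fin n) :
    0 < inputGain G i k := by
  unfold inputGain
  split_ifs
  exacts [Topology.g_pos hG i, one_pos]

/-- The error of the next layer, and zero after the last layer. -/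
noncomputable def Signals.nextErr [NeZero n] (s : Signals mS mF) (G : Topology N) (i : Fin N)
    (k : Fin n) (t : ℝ) : ℝ :=
  if h : (k : ℕ) + 1 < n then s.stepErr G i ⟨k + 1, h⟩ t else 0

/-- The combination of agent-wise quantities that enters the dynamics of the error of a layer:
in the first layer the one of the consensus error. -/
noncomputable def errMix (G : Topology N) (d₀ : Fin n → ℝ) (d : Fin N → Fin n → ℝ) (i : Fin N)
    (k : Fin n) : ℝ :=
  if (k : ℕ) = 0 then G.g i * d i k - ∑ l, G.a i l * d l k - G.b i * d₀ k else d i k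

/-- The disturbance that the estimate `dh i k` tracks. -/
noncomputable def Plant.errDist (P : Plant N n) (G : Topology N) (i : Fin N) (k : Fin n) (t : ℝ) :
    ℝ :=
  errMix G (fun k => P.d₀ k t) (fun i k => P.d i k t) i k

/-- The time derivative of `Plant.errDist`. -/
noncomputable def Plant.errDistDeriv (P : Plant N n) (G : Topology N) (i : Fin N) (k : Fin n)
    (t : ℝ) : ℝ :=
  errMix G (fun k => derivWithin (P.d₀ k) (Set.Ici 0) t)
    (fun i k => derivWithin (P.d i k) (Set.Ici 0) t) i k

lemma abs_errMix_le {G : Topology N} (hG : G.HasLeaderSpanningTree) {d₀ e₀ : Fin n → ℝ}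
    {d e : Fin N → Fin n → ℝ} (h₀ : ∀ k, |d₀ k| ≤ e₀ k) (h : ∀ i k, |d i k| ≤ e i k) (i : Fin N)
    (k : Fin n) :
    |errMix G d₀ d i k| ≤ if (k : ℕ) = 0 then
      G.g i * e i k + ∑ l, G.a i l * e l k + G.b i * e₀ k else e i k := by
  unfold errMix
  split_ifs
  · refine (abs_sub _ _).trans (add_le_add ((abs_sub _ _).trans (add_le_add ?_ ?_)) ?_)
    · rw [abs_mul, abs_of_pos (Topology.g_pos hG i)]
      exact mul_le_mul_of_nonneg_left (h i k) (Topology.g_pos hG i).le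
    · refine (Finset.abs_sum_le_sum_abs _ _).trans (Finset.sum_le_sum fun l _ => ?_)
      rw [abs_mul, abs_of_nonneg (G.a_nonneg i l)]
      exact mul_le_mul_of_nonneg_left (h l k) (G.a_nonneg i l)
    · rw [abs_mul, abs_of_nonneg (G.b_nonneg i)]
      exact mul_le_mul_of_nonneg_left (h₀ k) (G.b_nonneg i)
  · exact h i k

lemma Plant.Standing.abs_errDist_le {P : Plant N n} {U : Bounds N n} (hP : P.Standing U)
    {G : Topology N} (hG : G.HasLeaderSpanningTree) (i : Fin N) (k : Fin n) {t : ℝ} (ht : 0 ≤ t) :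
    |P.errDist G i k t| ≤ distBound G U i k :=
  abs_errMix_le hG (fun k => (hP.bound₀ k t ht).le) (fun i k => (hP.bound i k t ht).le) i k

lemma Plant.Standing.abs_errDistDeriv_le {P : Plant N n} {U : Bounds N n} (hP : P.Standing U)
    {G : Topology N} (hG : G.HasLeaderSpanningTree) (i : Fin N) (k : Fin n) {t : ℝ} (ht : 0 ≤ t) :
    |P.errDistDeriv G i k t| ≤ distDerivBound G U i k :=
  abs_errMix_le hG (fun k => (hP.derivBound₀ k t ht).le) (fun i k => (hP.derivBound i k t ht).le)
    i k

lemma Plant.Standing.hasDerivWithinAt_errDist {P : Plant N n} {U : Bounds N n}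
    (hP : P.Standing U) (G : Topology N) (i : Fin N) (k : Fin n) {t : ℝ} (ht : 0 ≤ t) :
    HasDerivWithinAt (P.errDist G i k) (P.errDistDeriv G i k t) (Set.Ici 0) t := by
  have h₀ := fun k => (hP.diff₀ k t ht).hasDerivWithinAt
  have h := fun i k => (hP.diff i k t ht).hasDerivWithinAt
  unfold Plant.errDistDeriv errMix
  by_cases hk : (k : ℕ) = 0
  · have e : P.errDist G i k = fun t =>
        G.g i * P.d i k t - ∑ l, G.a i l * P.d l k t - G.b i * P.d₀ k t := by
      funext t; simp [Plant.errDist, errMix, hk]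
    rw [e, if_pos hk]
    exact (((h i k).const_mul _).sub
      (HasDerivWithinAt.fun_sum fun l _ => (h l k).const_mul _)).sub ((h₀ k).const_mul _)
  · have e : P.errDist G i k = P.d i k := by
      funext t; simp [Plant.errDist, errMix, hk]
    rw [e, if_neg hk]
    exact h i k

variable [NeZero n] {G : Topology N} {P : Plant N n} {A : Networks mS mF} {K : Gains mS mF}
  {c : Coeffs N n} {s : Signals mS mF} {I : IdealWeights mS mF} {U : Bounds N n}

lemma Signals.next_eq (s : Signals mS mF) (G : Topology N) (i : Fin N) (k : Fin n) (t : ℝ) :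
    s.next i k t = s.nextErr G i k t + s.α i k t := by
  unfold Signals.next Signals.nextErr
  split_ifs
  · simp [Signals.stepErr]
  · simp

/-- The error of a layer as driven by the next error and the virtual control. -/
lemma IsClosedLoop.hasDerivWithinAt_stepErr (h : IsClosedLoop G P A K c s)
    (hA : ApproximatesAlong G P A I U s) (i : Fin N) (k : Fin n) {t : ℝ} (ht : 0 ≤ t) :
    HasDerivWithinAt (s.stepErr G i k)
      (inputGain G i k * (s.nextErr G i k t + s.α i k t) + s.unknownTerm G P i k t
        + P.errDist G i k t) (Set.Ici 0) t := by
  rw [← s.next_eq G]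
  by_cases hk : (k : ℕ) = 0
  · obtain rfl : k = 0 := Fin.ext (by simpa using hk)
    have e : s.stepErr G i 0 = fun t => ∑ l, G.a i l * (s.x i 0 t - s.x l 0 t) +
        G.b i * (s.x i 0 t - s.x₀ 0 t) := by
      funext t; simp [Signals.stepErr, Signals.consErr]
    rw [e]
    refine ((HasDerivWithinAt.fun_sum fun l _ =>
      ((h.follower i 0 t ht).sub (h.follower l 0 t ht)).const_mul (G.a i l)).add
      (((h.follower i 0 t ht).sub (h.leader 0 t ht)).const_mul (G.b i))).congr_deriv ?_
    simp only [inputGain, Signals.unknownTerm, Plant.errDist, errMix, hk, if_true, Topology.g,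
      mul_sub, mul_add, Finset.sum_sub_distrib, Finset.sum_add_distrib, add_mul, ← Finset.sum_mul]
    ring
  · set k' : Fin n := ⟨k - 1, lt_of_le_of_lt (Nat.sub_le _ _) k.2⟩ with hk'
    have e : s.stepErr G i k = fun t => s.x i k t - s.α i k' t := by
      funext t; simp [Signals.stepErr, hk, hk']
    have hd := hA.diff i k' (by have := k.2; simp only [hk']; omega) t ht
    rw [e]
    refine ((h.follower i k t ht).sub hd.hasDerivWithinAt).congr_deriv ?_
    simp only [inputGain, Signals.unknownTerm, Plant.errDist, errMix, hk, if_false]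
    ring

lemma IsClosedLoop.inputGain_mul_control (h : IsClosedLoop G P A K c s)
    (hG : G.HasLeaderSpanningTree) (i : Fin N) (k : Fin n) {t : ℝ} (ht : 0 ≤ t) :
    inputGain G i k * s.α i k t =
      -(K.k i k * s.stepErr G i k t) - s.Wa i k t ⬝ᵥ A.S i k (s.stepErr G i k t)
      - K.kp i k * oddPow p (s.stepErr G i k t) - K.kq i k * oddPow q (s.stepErr G i k t)
      - s.θ i k t ⬝ᵥ A.Φ i k (s.estInput i k t) - s.dh i k t - s.prevErr G i k t := by
  have hg := (inputGain_pos hG i k).ne'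
  rw [h.control i k t ht, Signals.vHat, Signals.hFix, ← inputGain]
  field_simp
  ring

/-! ### The Lyapunov function -/

/-- The energy `½ (w - w*)ᵀ Γ⁻¹ (w - w*)` of a weight estimate. -/
noncomputable def weightEnergy {m : ℕ} (Γ : Matrix (Fin m) (Fin m) ℝ) (ws w : Fin m → ℝ) : ℝ :=
  1 / 2 * ((w - ws) ⬝ᵥ Γ⁻¹ *ᵥ (w - ws))

lemma weightEnergy_nonneg {m : ℕ} {Γ : Matrix (Fin m) (Fin m) ℝ} (hΓ : Γ.PosDef)
    (ws w : Fin m → ℝ) : 0 ≤ weightEnergy Γ ws w :=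
  mul_nonneg (by norm_num) (by
    simpa using hΓ.inv.posSemidef.dotProduct_mulVec_nonneg (w - ws))

lemma hasDerivWithinAt_weightEnergy {m : ℕ} {Γ : Matrix (Fin m) (Fin m) ℝ} (hΓ : Γ.PosDef)
    (ws : Fin m → ℝ) {w : ℝ → Fin m → ℝ} {y : Fin m → ℝ} {D : Set ℝ} {t : ℝ}
    (hw : HasDerivWithinAt w (Γ *ᵥ y) D t) :
    HasDerivWithinAt (fun t => weightEnergy Γ ws (w t)) ((w t - ws) ⬝ᵥ y) D t := by
  have h1 : HasDerivWithinAt (fun t => w t - ws) (Γ *ᵥ y) D t := hw.sub_const ws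
  have h2 : HasDerivWithinAt (fun t => Γ⁻¹ *ᵥ (w t - ws)) (Γ⁻¹ *ᵥ (Γ *ᵥ y)) D t :=
    (LinearMap.toContinuousLinearMap (Matrix.mulVecLin Γ⁻¹)).hasFDerivAt.comp_hasDerivWithinAt t h1
  rw [inv_mulVec_mulVec hΓ] at h2
  have h3 : HasDerivWithinAt (fun t => weightEnergy Γ ws (w t))
      (1 / 2 * ∑ l, ((Γ *ᵥ y) l * (Γ⁻¹ *ᵥ (w t - ws)) l + (w t - ws) l * y l)) D t :=
    (HasDerivWithinAt.fun_sum fun l _ =>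
      (hasDerivWithinAt_pi.1 h1 l).mul (hasDerivWithinAt_pi.1 h2 l)).const_mul _
  refine h3.congr_deriv ?_
  have hsymm : (Γ *ᵥ y) ⬝ᵥ (Γ⁻¹ *ᵥ (w t - ws)) = (w t - ws) ⬝ᵥ y := by
    have hT : Γᵀ = Γ := by
      simpa [Matrix.conjTranspose_eq_transpose_of_trivial] using hΓ.isHermitian.eq
    rw [dotProduct_comm, Matrix.dotProduct_mulVec, ← hT, Matrix.vecMul_transpose, hT,
      mulVec_inv_mulVec hΓ]
  rw [Finset.sum_add_distrib]
  change 1 / 2 * ((Γ *ᵥ y) ⬝ᵥ (Γ⁻¹ *ᵥ (w t - ws)) + (w t - ws) ⬝ᵥ y) = _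
  rw [hsymm]; ring

/-- The Lyapunov function: the energies of the layer errors, of the critic, actor and estimator
weights, and of the disturbance estimates. -/
noncomputable def lyapunov (s : Signals mS mF) (G : Topology N) (P : Plant N n)
    (I : IdealWeights mS mF) (K : Gains mS mF) (t : ℝ) : ℝ :=
  ∑ j : Fin N × Fin n, 1 / 2 * s.stepErr G j.1 j.2 t ^ 2
    + ∑ j : Fin N × Fin n, weightEnergy (K.Γc j.1 j.2) (I.W j.1 j.2) (s.Wc j.1 j.2 t)
    + ∑ j : Fin N × Fin n, weightEnergy (K.Γa j.1 j.2) (I.W j.1 j.2) (s.Wa j.1 j.2 t)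
    + ∑ j : Fin N × Fin n, weightEnergy (K.Γθ j.1 j.2) (I.θ j.1 j.2) (s.θ j.1 j.2 t)
    + ∑ j : Fin N × Fin n, (s.dh j.1 j.2 t - P.errDist G j.1 j.2 t) ^ 2 / (2 * K.γ j.1 j.2)

/-- The contribution of a layer to the time derivative of the Lyapunov function, with the right-hand
sides of the closed loop substituted. -/
noncomputable def layerRate (s : Signals mS mF) (G : Topology N) (P : Plant N n)
    (A : Networks mS mF) (I : IdealWeights mS mF) (K : Gains mS mF) (c : Coeffs N n) (i : Fin N)
    (k : Fin n) (t : ℝ) : ℝ :=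
  s.stepErr G i k t *
    (inputGain G i k * (s.nextErr G i k t + s.α i k t) + s.unknownTerm G P i k t
      + P.errDist G i k t)
  + (s.Wc i k t - I.W i k) ⬝ᵥ (-(s.stepErr G i k t • A.S i k (s.stepErr G i k t))
      - c.σ1c i k • (Matrix.vecMulVec (A.S i k (s.stepErr G i k t))
          (A.S i k (s.stepErr G i k t)) *ᵥ s.Wc i k t)
      - c.σ2c i k • oddPowVec p (s.Wc i k t)
      - c.σ3c i k • oddPowVec q (s.Wc i k t))
  + (s.Wa i k t - I.W i k) ⬝ᵥ (-(c.σ1a i k • (Matrix.vecMulVec (A.S i k (s.stepErr G i k t))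
          (A.S i k (s.stepErr G i k t)) *ᵥ (s.Wa i k t - s.Wc i k t)))
      - c.σ2a i k • oddPowVec p (s.Wa i k t - s.Wc i k t)
      - c.σ3a i k • oddPowVec q (s.Wa i k t - s.Wc i k t))
  + (s.θ i k t - I.θ i k) ⬝ᵥ (s.stepErr G i k t • A.Φ i k (s.estInput i k t)
      - c.σ1θ i k • oddPowVec p (s.θ i k t)
      - c.σ2θ i k • oddPowVec q (s.θ i k t))
  + ((s.dh i k t - P.errDist G i k t) * (s.stepErr G i k t - c.σ1d i k * oddPow p (s.dh i k t)
      - c.σ2d i k * oddPow q (s.dh i k t))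
    - (s.dh i k t - P.errDist G i k t) * P.errDistDeriv G i k t / K.γ i k)

lemma IsClosedLoop.hasDerivWithinAt_lyapunov (h : IsClosedLoop G P A K c s)
    (hA : ApproximatesAlong G P A I U s) (hP : P.Standing U) (hK : K.Admissible) {t : ℝ}
    (ht : 0 ≤ t) :
    HasDerivWithinAt (lyapunov s G P I K)
      (∑ j : Fin N × Fin n, layerRate s G P A I K c j.1 j.2 t) (Set.Ici 0) t := by
  have hz : ∀ j : Fin N × Fin n, HasDerivWithinAt (fun t => 1 / 2 * s.stepErr G j.1 j.2 t ^ 2)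
      (s.stepErr G j.1 j.2 t *
        (inputGain G j.1 j.2 * (s.nextErr G j.1 j.2 t + s.α j.1 j.2 t)
          + s.unknownTerm G P j.1 j.2 t + P.errDist G j.1 j.2 t)) (Set.Ici 0) t := fun j =>
    (((h.hasDerivWithinAt_stepErr hA j.1 j.2 ht).pow 2).const_mul (1 / 2)).congr_deriv
      (by norm_num; ring)
  have hd : ∀ j : Fin N × Fin n, HasDerivWithinAt
      (fun t => (s.dh j.1 j.2 t - P.errDist G j.1 j.2 t) ^ 2 / (2 * K.γ j.1 j.2))
      ((s.dh j.1 j.2 t - P.errDist G j.1 j.2 t) *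
        (s.stepErr G j.1 j.2 t - c.σ1d j.1 j.2 * oddPow p (s.dh j.1 j.2 t)
          - c.σ2d j.1 j.2 * oddPow q (s.dh j.1 j.2 t))
        - (s.dh j.1 j.2 t - P.errDist G j.1 j.2 t) * P.errDistDeriv G j.1 j.2 t / K.γ j.1 j.2)
      (Set.Ici 0) t := fun j => by
    have hγ := (hK.γ_pos j.1 j.2).ne'
    refine ((((h.disturbance j.1 j.2 t ht).sub (hP.hasDerivWithinAt_errDist G j.1 j.2 ht)).pow
      2).div_const (2 * K.γ j.1 j.2)).congr_deriv ?_
    simp only [Pi.sub_apply]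
    field_simp
    norm_num
    ring
  refine (((((HasDerivWithinAt.fun_sum fun j _ => hz j).add
    (HasDerivWithinAt.fun_sum fun j _ => hasDerivWithinAt_weightEnergy (hK.Γc_pos j.1 j.2)
      (I.W j.1 j.2) (h.critic j.1 j.2 t ht))).add
    (HasDerivWithinAt.fun_sum fun j _ => hasDerivWithinAt_weightEnergy (hK.Γa_pos j.1 j.2)
      (I.W j.1 j.2) (h.actor j.1 j.2 t ht))).add
    (HasDerivWithinAt.fun_sum fun j _ => hasDerivWithinAt_weightEnergy (hK.Γθ_pos j.1 j.2)
      (I.θ j.1 j.2) (h.estimator j.1 j.2 t ht))).add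
    (HasDerivWithinAt.fun_sum fun j _ => hd j)).congr_deriv ?_
  simp only [← Finset.sum_add_distrib]
  rfl

/-- The decay that a layer contributes to the time derivative of the Lyapunov function. -/
noncomputable def layerDecay (s : Signals mS mF) (G : Topology N) (P : Plant N n)
    (I : IdealWeights mS mF) (K : Gains mS mF) (c : Coeffs N n) (i : Fin N) (k : Fin n) (t : ℝ) :
    ℝ :=
  (K.kp i k * |s.stepErr G i k t| ^ (p + 1) + K.kq i k * s.stepErr G i k t ^ 4)
  + ((c.σ2c i k / 2 - c.σ2a i k) * powSum (p + 1) (s.Wc i k t - I.W i k)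
    + (c.σ3c i k / 8 - 172 * c.σ3a i k) * powSum (q + 1) (s.Wc i k t - I.W i k)
    + c.σ2a i k / 2 * powSum (p + 1) (s.Wa i k t - I.W i k)
    + c.σ3a i k / 8 * powSum (q + 1) (s.Wa i k t - I.W i k))
  + (c.σ1θ i k / 2 * powSum (p + 1) (s.θ i k t - I.θ i k)
    + c.σ2θ i k / 8 * powSum (q + 1) (s.θ i k t - I.θ i k))
  + (c.σ1d i k / 2 * |s.dh i k t - P.errDist G i k t| ^ (p + 1)
    + (c.σ2d i k / 8 - 1 / (4 * c.μ i k ^ 4)) * (s.dh i k t - P.errDist G i k t) ^ 4)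

lemma IsClosedLoop.layerRate_le (h : IsClosedLoop G P A K c s) (hG : G.HasLeaderSpanningTree)
    (hA : ApproximatesAlong G P A I U s) (hP : P.Standing U) (hK : K.Admissible)
    (hc : c.Admissible) (hS : ∀ i k r, A.S i k r ⬝ᵥ A.S i k r ≤ U.lamS i k) (i : Fin N)
    (k : Fin n) {t : ℝ} (ht : 0 ≤ t) :
    layerRate s G P A I K c i k t ≤
      (inputGain G i k * s.stepErr G i k t * s.nextErr G i k t
        - s.stepErr G i k t * s.prevErr G i k t)
      + layerConst G I U K c i k - layerDecay s G P I K c i k t := by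
  have hac := actorCritic_bound (Wc := s.Wc i k t) (Wa := s.Wa i k t) (W := I.W i k)
    (z := s.stepErr G i k t) (hS i k (s.stepErr G i k t)) (hc.actor1 i k) (hc.critic1 i k)
    (hc.actor2 i k) (hc.critic2 i k) (hc.actor3 i k) (hc.critic3 i k)
  have hest := estimator_bound (Φ := A.Φ i k (s.estInput i k t)) (θ := s.θ i k t)
    (θs := I.θ i k) (z := s.stepErr G i k t) (hc.est1 i k) (hc.est2 i k)
  have hdist := disturbance_bound (z := s.stepErr G i k t) (dh := s.dh i k t)
    (hK.γ_pos i k) (hc.μ_pos i k) (hc.dist1 i k) (hc.σ2d_pos i k)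
    (hP.abs_errDist_le hG i k ht) (hP.abs_errDistDeriv_le hG i k ht)
  have herr := hA.err i k t ht
  have hctl := h.inputGain_mul_control hG i k ht
  have hp := mul_oddPow_p (s.stepErr G i k t)
  have hq := oddPow_q (s.stepErr G i k t)
  have hk := hK.k_gt i k
  unfold layerRate layerConst layerDecay
  rw [mul_add (inputGain G i k), hctl, ← hp, hq]
  generalize s.stepErr G i k t = z at *
  have hyoung : z * (s.unknownTerm G P i k t - I.θ i k ⬝ᵥ A.Φ i k (s.estInput i k t)) ≤
      z ^ 2 / 2 + U.deltaBar i k / 2 := by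
    nlinarith [sq_nonneg (z - (s.unknownTerm G P i k t - I.θ i k ⬝ᵥ A.Φ i k (s.estInput i k t)))]
  have hkz : 3 / 2 * z ^ 2 ≤ K.k i k * z ^ 2 := by gcongr
  linarith

/-- The cross terms of consecutive layers cancel. -/
lemma sum_coupling_eq_zero (s : Signals mS mF) (G : Topology N) (t : ℝ) :
    ∑ j : Fin N × Fin n, (inputGain G j.1 j.2 * s.stepErr G j.1 j.2 t * s.nextErr G j.1 j.2 t
      - s.stepErr G j.1 j.2 t * s.prevErr G j.1 j.2 t) = 0 := by
  rw [Fintype.sum_prod_type]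
  refine Finset.sum_eq_zero fun i _ => ?_
  rw [Finset.sum_sub_distrib, sub_eq_zero]
  have shift : ∀ (m : ℕ) (X Y : Fin m → ℝ), (∀ k : Fin m, (k : ℕ) = 0 → Y k = 0) →
      (∀ k : Fin m, ¬ (k : ℕ) + 1 < m → X k = 0) →
      (∀ (k : Fin m) (hk : (k : ℕ) + 1 < m), X k = Y ⟨k + 1, hk⟩) → ∑ k, X k = ∑ k, Y k := by
    intro m X Y hY hX hXY
    cases m with
    | zero => simp
    | succ m =>
      rw [Fin.sum_univ_castSucc, Fin.sum_univ_succ, hY 0 rfl, hX (Fin.last m) (by simp), add_zero,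
        zero_add]
      exact Finset.sum_congr rfl fun k _ => hXY k.castSucc (by simp)
  refine shift n _ _ (fun k hk => ?_) (fun k hk => ?_) (fun k hk => ?_)
  · simp [Signals.prevErr, hk]
  · simp [Signals.nextErr, hk]
  · simp only [Signals.nextErr, hk, dif_pos, Signals.prevErr, Nat.add_eq_zero_iff, one_ne_zero,
      and_false, if_false, inputGain, Nat.add_eq_right, Nat.add_sub_cancel]
    ring

variable [NeZero N]

lemma numLayers_pos : 0 < numLayers N n := by
  have h1 : 0 < n := NeZero.pos n
  have h2 : 0 < N := NeZero.pos N
  unfold numLayers; positivity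

lemma numNeurons_pos {m : Fin N → Fin n → ℕ} (hm : ∀ i k, 0 < m i k) : 0 < numNeurons m := by
  rw [numNeurons_eq]
  exact Finset.sum_pos (fun j _ => by exact_mod_cast hm j.1 j.2) ⟨(0, 0), Finset.mem_univ _⟩

lemma layerMax_lamMax_inv_pos {m : Fin N → Fin n → ℕ} (hm : ∀ i k, 0 < m i k)
    {Γ : ∀ i k, Matrix (Fin (m i k)) (Fin (m i k)) ℝ} (hΓ : ∀ i k, (Γ i k).PosDef) :
    0 < layerMax fun i k => lamMax (Γ i k)⁻¹ :=
  layerMax_pos fun i k => lamMax_inv_pos (hΓ i k) (hm i k)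

lemma rateP_pos (hmS : ∀ i k, 0 < mS i k) (hmF : ∀ i k, 0 < mF i k)
    (hK : K.Admissible) (hc : c.Admissible) :
    0 < rateP K c := by
  have := layerMax_lamMax_inv_pos hmS hK.Γc_pos
  have := layerMax_lamMax_inv_pos hmS hK.Γa_pos
  have := layerMax_lamMax_inv_pos hmF hK.Γθ_pos
  have := layerMin_pos hK.kp_pos
  have := layerMin_pos hK.γ_pos
  have := layerMin_pos hc.critic_p_pos
  have := layerMin_pos hc.actor2
  have := layerMin_pos hc.est1
  have := layerMin_pos hc.dist1
  exact lt_min (by positivity) (lt_min (by positivity) (lt_min (by positivity)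
    (lt_min (by positivity) (by positivity))))

lemma rateQ_pos (hmS : ∀ i k, 0 < mS i k) (hmF : ∀ i k, 0 < mF i k)
    (hK : K.Admissible) (hc : c.Admissible) :
    0 < rateQ K c := by
  have := layerMax_lamMax_inv_pos hmS hK.Γc_pos
  have := layerMax_lamMax_inv_pos hmS hK.Γa_pos
  have := layerMax_lamMax_inv_pos hmF hK.Γθ_pos
  have := layerMin_pos hK.kq_pos
  have := layerMin_pos hK.γ_pos
  have := layerMin_pos hc.critic_q_pos
  have := layerMin_pos (F := fun i k => c.σ3a i k / 8) fun i k => by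
    have := hc.actor3 i k; positivity
  have := layerMin_pos (F := fun i k => c.σ2θ i k / 8) fun i k => by
    have := hc.est2 i k; positivity
  have := layerMin_pos hc.dist_q_pos
  have := numNeurons_pos hmS
  have := numNeurons_pos hmF
  have := numLayers_pos (N := N) (n := n)
  exact mul_pos (by positivity) (lt_min (by positivity) (lt_min (by positivity)
    (lt_min (by positivity) (lt_min (by positivity) (by positivity)))))

lemma weightEnergy_le {m : Fin N → Fin n → ℕ} (hm : ∀ i k, 0 < m i k)
    {Γ : ∀ i k, Matrix (Fin (m i k)) (Fin (m i k)) ℝ} (hΓ : ∀ i k, (Γ i k).PosDef)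
    (i : Fin N) (k : Fin n) (ws w : Fin (m i k) → ℝ) :
    2 / (layerMax fun i k => lamMax (Γ i k)⁻¹) * weightEnergy (Γ i k) ws w ≤
      (w - ws) ⬝ᵥ (w - ws) := by
  have hpos := layerMax_lamMax_inv_pos hm hΓ
  have h1 := dotProduct_mulVec_le_lamMax (hΓ i k).inv.isHermitian (w - ws)
  have h2 := mul_le_mul_of_nonneg_right (le_layerMax (fun i k => lamMax (Γ i k)⁻¹) i k)
    (dotProduct_self_nonneg (w - ws))
  rw [div_mul_eq_mul_div, div_le_iff₀ hpos, weightEnergy]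
  linarith

/-- The decay of all layers dominates the powers of the Lyapunov function. -/
lemma rate_mul_lyapunov_le (hmS : ∀ i k, 0 < mS i k) (hmF : ∀ i k, 0 < mF i k)
    (hK : K.Admissible) (hc : c.Admissible) (t : ℝ) :
    rateP K c * lyapunov s G P I K t ^ pLyap + rateQ K c * lyapunov s G P I K t ^ 2 ≤
      ∑ j : Fin N × Fin n, layerDecay s G P I K c j.1 j.2 t := by
  have hlc : 0 < 2 / layerMax fun i k => lamMax (K.Γc i k)⁻¹ :=
    div_pos two_pos (layerMax_lamMax_inv_pos hmS hK.Γc_pos)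
  have hla : 0 < 2 / layerMax fun i k => lamMax (K.Γa i k)⁻¹ :=
    div_pos two_pos (layerMax_lamMax_inv_pos hmS hK.Γa_pos)
  have hlθ : 0 < 2 / layerMax fun i k => lamMax (K.Γθ i k)⁻¹ :=
    div_pos two_pos (layerMax_lamMax_inv_pos hmF hK.Γθ_pos)
  have hlγ : 0 < 2 * layerMin K.γ := mul_pos two_pos (layerMin_pos hK.γ_pos)
  have hz0 : ∀ j : Fin N × Fin n, 0 ≤ 1 / 2 * s.stepErr G j.1 j.2 t ^ 2 := fun j => by positivity
  have hz : ∀ j : Fin N × Fin n, 2 * (1 / 2 * s.stepErr G j.1 j.2 t ^ 2) ≤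
      (fun _ : Fin 1 => s.stepErr G j.1 j.2 t) ⬝ᵥ fun _ => s.stepErr G j.1 j.2 t := fun j => by
    simp [dotProduct, sq]
  have hc0 := fun j : Fin N × Fin n =>
    weightEnergy_nonneg (hK.Γc_pos j.1 j.2) (I.W j.1 j.2) (s.Wc j.1 j.2 t)
  have hce := fun j : Fin N × Fin n =>
    weightEnergy_le hmS hK.Γc_pos j.1 j.2 (I.W j.1 j.2) (s.Wc j.1 j.2 t)
  have ha0 := fun j : Fin N × Fin n =>
    weightEnergy_nonneg (hK.Γa_pos j.1 j.2) (I.W j.1 j.2) (s.Wa j.1 j.2 t)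
  have hae := fun j : Fin N × Fin n =>
    weightEnergy_le hmS hK.Γa_pos j.1 j.2 (I.W j.1 j.2) (s.Wa j.1 j.2 t)
  have hθ0 := fun j : Fin N × Fin n =>
    weightEnergy_nonneg (hK.Γθ_pos j.1 j.2) (I.θ j.1 j.2) (s.θ j.1 j.2 t)
  have hθe := fun j : Fin N × Fin n =>
    weightEnergy_le hmF hK.Γθ_pos j.1 j.2 (I.θ j.1 j.2) (s.θ j.1 j.2 t)
  have hd0 : ∀ j : Fin N × Fin n,
      0 ≤ (s.dh j.1 j.2 t - P.errDist G j.1 j.2 t) ^ 2 / (2 * K.γ j.1 j.2) := fun j => by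
    have := hK.γ_pos j.1 j.2
    positivity
  have hd : ∀ j : Fin N × Fin n, 2 * layerMin K.γ *
      ((s.dh j.1 j.2 t - P.errDist G j.1 j.2 t) ^ 2 / (2 * K.γ j.1 j.2)) ≤
      (fun _ : Fin 1 => s.dh j.1 j.2 t - P.errDist G j.1 j.2 t) ⬝ᵥ
        fun _ => s.dh j.1 j.2 t - P.errDist G j.1 j.2 t := fun j => by
    have hγ := hK.γ_pos j.1 j.2
    have h1 := mul_le_mul_of_nonneg_right (layerMin_le K.γ j.1 j.2)
      (sq_nonneg (s.dh j.1 j.2 t - P.errDist G j.1 j.2 t))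
    rw [← mul_div_assoc, div_le_iff₀ (by positivity)]
    simp only [dotProduct, Finset.univ_unique, Finset.sum_const, Finset.card_singleton, one_smul]
    linarith
  have mp1 := layerMin_pos hK.kp_pos
  have mp2 := layerMin_pos hc.critic_p_pos
  have mp3 := layerMin_pos hc.actor2
  have mp4 := layerMin_pos hc.est1
  have mp5 := layerMin_pos hc.dist1
  have mq1 := layerMin_pos hK.kq_pos
  have mq2 := layerMin_pos hc.critic_q_pos
  have mq3 := layerMin_pos (F := fun i k => c.σ3a i k / 8) fun i k => by
    have := hc.actor3 i k; positivity
  have mq4 := layerMin_pos (F := fun i k => c.σ2θ i k / 8) fun i k => by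
    have := hc.est2 i k; positivity
  have mq5 := layerMin_pos hc.dist_q_pos
  have p1 := energy_rpow_pLyap_le (fun j (_ : Fin 1) => s.stepErr G j.1 j.2 t) two_pos hz0 hz
    mp1.le (coef := fun j => K.kp j.1 j.2) (fun j => layerMin_le _ j.1 j.2)
  have p2 := energy_rpow_pLyap_le (fun j => s.Wc j.1 j.2 t - I.W j.1 j.2) hlc hc0 hce
    mp2.le (coef := fun j => c.σ2c j.1 j.2 / 2 - c.σ2a j.1 j.2)
    (fun j => layerMin_le (fun i k => c.σ2c i k / 2 - c.σ2a i k) j.1 j.2)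
  have p3 := energy_rpow_pLyap_le (fun j => s.Wa j.1 j.2 t - I.W j.1 j.2) hla ha0 hae
    (half_pos mp3).le (coef := fun j => c.σ2a j.1 j.2 / 2)
    (fun j => div_le_div_of_nonneg_right (layerMin_le _ j.1 j.2) two_pos.le)
  have p4 := energy_rpow_pLyap_le (fun j => s.θ j.1 j.2 t - I.θ j.1 j.2) hlθ hθ0 hθe
    (half_pos mp4).le (coef := fun j => c.σ1θ j.1 j.2 / 2)
    (fun j => div_le_div_of_nonneg_right (layerMin_le _ j.1 j.2) two_pos.le)
  have p5 := energy_rpow_pLyap_le (fun j (_ : Fin 1) => s.dh j.1 j.2 t - P.errDist G j.1 j.2 t)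
    hlγ hd0 hd (half_pos mp5).le (coef := fun j => c.σ1d j.1 j.2 / 2)
    (fun j => div_le_div_of_nonneg_right (layerMin_le _ j.1 j.2) two_pos.le)
  have q1 := energy_sq_le (fun j (_ : Fin 1) => s.stepErr G j.1 j.2 t) two_pos hz0 hz
    mq1.le (coef := fun j => K.kq j.1 j.2) (fun j => layerMin_le _ j.1 j.2)
    numLayers_eq numLayers_pos
  have q2 := energy_sq_le (fun j => s.Wc j.1 j.2 t - I.W j.1 j.2) hlc hc0 hce
    mq2.le (coef := fun j => c.σ3c j.1 j.2 / 8 - 172 * c.σ3a j.1 j.2)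
    (fun j => layerMin_le (fun i k => c.σ3c i k / 8 - 172 * c.σ3a i k) j.1 j.2)
    (numNeurons_eq mS) (numNeurons_pos hmS)
  have q3 := energy_sq_le (fun j => s.Wa j.1 j.2 t - I.W j.1 j.2) hla ha0 hae
    mq3.le (coef := fun j => c.σ3a j.1 j.2 / 8)
    (fun j => layerMin_le (fun i k => c.σ3a i k / 8) j.1 j.2)
    (numNeurons_eq mS) (numNeurons_pos hmS)
  have q4 := energy_sq_le (fun j => s.θ j.1 j.2 t - I.θ j.1 j.2) hlθ hθ0 hθe
    mq4.le (coef := fun j => c.σ2θ j.1 j.2 / 8)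
    (fun j => layerMin_le (fun i k => c.σ2θ i k / 8) j.1 j.2)
    (numNeurons_eq mF) (numNeurons_pos hmF)
  have q5 := energy_sq_le (fun j (_ : Fin 1) => s.dh j.1 j.2 t - P.errDist G j.1 j.2 t)
    hlγ hd0 hd mq5.le (coef := fun j => c.σ2d j.1 j.2 / 8 - 1 / (4 * c.μ j.1 j.2 ^ 4))
    (fun j => layerMin_le (fun i k => c.σ2d i k / 8 - 1 / (4 * c.μ i k ^ 4)) j.1 j.2)
    numLayers_eq numLayers_pos
  have s1 := Finset.sum_nonneg fun j (_ : j ∈ Finset.univ) => hz0 j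
  have s2 := Finset.sum_nonneg fun j (_ : j ∈ Finset.univ) => hc0 j
  have s3 := Finset.sum_nonneg fun j (_ : j ∈ Finset.univ) => ha0 j
  have s4 := Finset.sum_nonneg fun j (_ : j ∈ Finset.univ) => hθ0 j
  have s5 := Finset.sum_nonneg fun j (_ : j ∈ Finset.univ) => hd0 j
  simp only [powSum_p_const, powSum_q_const] at p1 p5 q1 q5
  have hP0 := rateP_pos hmS hmF hK hc
  have hQ0 := rateQ_pos hmS hmF hK hc
  simp only [layerDecay, Finset.sum_add_distrib]
  unfold lyapunov
  generalize ∑ j : Fin N × Fin n, 1 / 2 * s.stepErr G j.1 j.2 t ^ 2 = V1 at *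
  generalize ∑ j : Fin N × Fin n,
    weightEnergy (K.Γc j.1 j.2) (I.W j.1 j.2) (s.Wc j.1 j.2 t) = V2 at *
  generalize ∑ j : Fin N × Fin n,
    weightEnergy (K.Γa j.1 j.2) (I.W j.1 j.2) (s.Wa j.1 j.2 t) = V3 at *
  generalize ∑ j : Fin N × Fin n,
    weightEnergy (K.Γθ j.1 j.2) (I.θ j.1 j.2) (s.θ j.1 j.2 t) = V4 at *
  generalize ∑ j : Fin N × Fin n,
    (s.dh j.1 j.2 t - P.errDist G j.1 j.2 t) ^ 2 / (2 * K.γ j.1 j.2) = V5 at *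
  have hVp := mul_le_mul_of_nonneg_left (rpow_pLyap_add_five_le s1 s2 s3 s4 s5) hP0.le
  have hVq := mul_le_mul_of_nonneg_left (sq_add_five_le V1 V2 V3 V4 V5) hQ0.le
  have rp : ∀ {r V : ℝ}, rateP K c ≤ r → 0 ≤ V → rateP K c * V ^ pLyap ≤ r * V ^ pLyap :=
    fun h hV => mul_le_mul_of_nonneg_right h (Real.rpow_nonneg hV _)
  have rq : ∀ {r : ℝ} (V : ℝ), rateQ K c * 5 ≤ r → rateQ K c * 5 * V ^ 2 ≤ r * V ^ 2 :=
    fun V h => mul_le_mul_of_nonneg_right h (sq_nonneg V)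
  have hQ5 : ∀ x : ℝ, (5 : ℝ) ^ (1 - qLyap) * x * 5 = x := fun x => by
    rw [qLyap_eq, show (1 : ℝ) - 2 = -1 by norm_num, Real.rpow_neg_one]; ring
  have p1' := rp (min_le_left _ _) s1
  have p2' := rp ((min_le_right _ _).trans (min_le_left _ _)) s2
  have p3' := rp ((min_le_right _ _).trans ((min_le_right _ _).trans (min_le_left _ _))) s3
  have p4' := rp ((min_le_right _ _).trans ((min_le_right _ _).trans
    ((min_le_right _ _).trans (min_le_left _ _)))) s4
  have p5' := rp ((min_le_right _ _).trans ((min_le_right _ _).trans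
    ((min_le_right _ _).trans (min_le_right _ _)))) s5
  have q1' := rq V1 ((hQ5 _).le.trans (min_le_left _ _))
  have q2' := rq V2 ((hQ5 _).le.trans ((min_le_right _ _).trans (min_le_left _ _)))
  have q3' := rq V3 ((hQ5 _).le.trans ((min_le_right _ _).trans
    ((min_le_right _ _).trans (min_le_left _ _))))
  have q4' := rq V4 ((hQ5 _).le.trans ((min_le_right _ _).trans ((min_le_right _ _).trans
    ((min_le_right _ _).trans (min_le_left _ _)))))
  have q5' := rq V5 ((hQ5 _).le.trans ((min_le_right _ _).trans ((min_le_right _ _).trans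
    ((min_le_right _ _).trans (min_le_right _ _)))))
  linarith

end FixedTimeConsensus

namespace FixedTimeConsensus

variable {N n : ℕ} {mS mF : Fin N → Fin n → ℕ} {G : Topology N} {P : Plant N n}
  {A : Networks mS mF} {K : Gains mS mF} {c : Coeffs N n} {s : Signals mS mF}
  {I : IdealWeights mS mF} {U : Bounds N n}

/-! ### The ultimate bound -/

lemma distBound_pos (hG : G.HasLeaderSpanningTree) (hU : U.Valid) (i : Fin N) (k : Fin n) :
    0 < distBound G U i k := by
  unfold distBound
  have hs : 0 ≤ ∑ l, G.a i l * U.dBar l k :=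
    Finset.sum_nonneg fun l _ => mul_nonneg (G.a_nonneg i l) (hU.dBar_pos l k).le
  have hb := mul_nonneg (G.b_nonneg i) (hU.dBar₀_pos k).le
  have hg := mul_pos (Topology.g_pos hG i) (hU.dBar_pos i k)
  split_ifs
  · linarith
  · exact hU.dBar_pos i k

lemma distDerivBound_nonneg (hG : G.HasLeaderSpanningTree) (hU : U.Valid) (i : Fin N)
    (k : Fin n) : 0 ≤ distDerivBound G U i k := by
  unfold distDerivBound
  have hs : 0 ≤ ∑ l, G.a i l * U.ddBar l k :=
    Finset.sum_nonneg fun l _ => mul_nonneg (G.a_nonneg i l) (hU.ddBar_pos l k).le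
  have hb := mul_nonneg (G.b_nonneg i) (hU.ddBar₀_pos k).le
  have hg := mul_pos (Topology.g_pos hG i) (hU.ddBar_pos i k)
  split_ifs
  · linarith
  · exact (hU.ddBar_pos i k).le

lemma layerConst_pos (hG : G.HasLeaderSpanningTree) (hU : U.Valid) (hc : c.Admissible)
    (hγ : ∀ i k, 0 < K.γ i k) (i : Fin N) (k : Fin n) : 0 < layerConst G I U K c i k := by
  have h1 := hU.deltaBar_nonneg i k
  have h2 := hU.lamS_nonneg i k
  have h3 := dotProduct_self_nonneg (I.W i k)
  have h4 := hc.actor1 i k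
  have h5 := hc.critic1 i k
  have h6 := hc.actor2 i k
  have h7 := hc.critic2 i k
  have h8 := hc.actor3 i k
  have h9 := hc.critic3 i k
  have hσ1c : 0 ≤ c.σ1c i k := by linarith
  have hσ2c : 0 ≤ c.σ2c i k := by linarith
  have hσ3c : 0 ≤ c.σ3c i k := by linarith
  have h10 := (hc.est1 i k).le
  have h11 := (hc.est2 i k).le
  have h12 := hc.dist1 i k
  have h13 := (hc.σ2d_pos i k).le
  have hD := distBound_pos hG hU i k
  have hD' := distDerivBound_nonneg hG hU i k
  have hμ := hc.μ_pos i k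
  have hγ' := hγ i k
  have w1 := powSum_nonneg (p + 1) (I.W i k)
  have w2 := powSum_nonneg (q + 1) (I.W i k)
  have w3 := powSum_nonneg (p + 1) (I.θ i k)
  have w4 := powSum_nonneg (q + 1) (I.θ i k)
  unfold layerConst
  positivity

lemma totalConst_pos [NeZero N] [NeZero n] (hG : G.HasLeaderSpanningTree) (hU : U.Valid)
    (hc : c.Admissible) (hγ : ∀ i k, 0 < K.γ i k) : 0 < totalConst G I U K c :=
  Finset.sum_pos (fun i _ => Finset.sum_pos (fun k _ => layerConst_pos hG hU hc hγ i k)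
    Finset.univ_nonempty) Finset.univ_nonempty

/-- Only the bound of the derivative of the disturbance enters `layerConst` together with a gain,
and it is damped by `γ`. -/
lemma totalConst_le (hG : G.HasLeaderSpanningTree) (hU : U.Valid) (hc : c.Admissible)
    {K₁ : Gains mS mF} (hγ₁ : ∀ i k, 0 < K₁.γ i k) (hγ : ∀ i k, K₁.γ i k ≤ K.γ i k) :
    totalConst G I U K c ≤ totalConst G I U K₁ c := by
  refine Finset.sum_le_sum fun i _ => Finset.sum_le_sum fun k _ => ?_
  have h1 := hγ₁ i k
  have h2 := hγ i k
  have hμ := hc.μ_pos i k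
  have hD := distDerivBound_nonneg hG hU i k
  have h3 : (c.μ i k / K.γ i k) ^ (4 / 3 : ℝ) ≤ (c.μ i k / K₁.γ i k) ^ (4 / 3 : ℝ) :=
    Real.rpow_le_rpow (div_nonneg hμ.le (h1.le.trans h2)) (by gcongr) (by norm_num)
  unfold layerConst
  gcongr

lemma Tmax_eq (K : Gains mS mF) (c : Coeffs N n) :
    Tmax K c = 3 / rateP K c + 1 / rateQ K c := by
  rw [Tmax, pLyap_eq, qLyap_eq, show (1 : ℝ) - 2 / 3 = 1 / 3 by norm_num,
    show (2 : ℝ) - 1 = 1 by norm_num, mul_one, mul_one_div, one_div_div]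

variable [NeZero n]

lemma eucl_consErr_le (hK : K.Admissible) (t : ℝ) :
    eucl (s.consErr G t) ≤ √(2 * lyapunov s G P I K t) := by
  refine Real.sqrt_le_sqrt ?_
  have h1 : ∑ i, s.consErr G t i ^ 2 ≤ 2 * ∑ j : Fin N × Fin n,
      1 / 2 * s.stepErr G j.1 j.2 t ^ 2 := by
    rw [Fintype.sum_prod_type, Finset.mul_sum]
    refine Finset.sum_le_sum fun i _ => ?_
    have h := Finset.single_le_sum (f := fun k : Fin n => 1 / 2 * s.stepErr G i k t ^ 2)
      (fun k _ => by positivity) (Finset.mem_univ 0)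
    have h0 : s.stepErr G i 0 t = s.consErr G t i := by simp [Signals.stepErr]
    simp only [h0] at h
    linarith
  have h2 := Finset.sum_nonneg fun (j : Fin N × Fin n) (_ : j ∈ Finset.univ) =>
    weightEnergy_nonneg (hK.Γc_pos j.1 j.2) (I.W j.1 j.2) (s.Wc j.1 j.2 t)
  have h3 := Finset.sum_nonneg fun (j : Fin N × Fin n) (_ : j ∈ Finset.univ) =>
    weightEnergy_nonneg (hK.Γa_pos j.1 j.2) (I.W j.1 j.2) (s.Wa j.1 j.2 t)
  have h4 := Finset.sum_nonneg fun (j : Fin N × Fin n) (_ : j ∈ Finset.univ) =>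
    weightEnergy_nonneg (hK.Γθ_pos j.1 j.2) (I.θ j.1 j.2) (s.θ j.1 j.2 t)
  have h5 : 0 ≤ ∑ j : Fin N × Fin n,
      (s.dh j.1 j.2 t - P.errDist G j.1 j.2 t) ^ 2 / (2 * K.γ j.1 j.2) :=
    Finset.sum_nonneg fun j _ => by
      have := hK.γ_pos j.1 j.2
      positivity
  unfold lyapunov
  linarith

variable [NeZero N]

/-- The consensus error enters its ultimate bound before the fraction `17 / 20` of `Tmax / ϑ`. -/
lemma eucl_consErr_le_radiusE (hmS : ∀ i k, 0 < mS i k) (hmF : ∀ i k, 0 < mF i k)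
    (hG : G.HasLeaderSpanningTree) (hU : U.Valid)
    (hS : ∀ i k r, A.S i k r ⬝ᵥ A.S i k r ≤ U.lamS i k) (hc : c.Admissible) {ϑ : ℝ}
    (hϑ₀ : 0 < ϑ) (hϑ₁ : ϑ < 1) (hK : K.Admissible) (hP : P.Standing U)
    (h : IsClosedLoop G P A K c s) (hA : ApproximatesAlong G P A I U s) {t : ℝ}
    (ht : 17 / 20 * Tmax K c / ϑ ≤ t) :
    eucl (s.consErr G t) ≤ radiusE G I U K c ϑ := by
  refine (eucl_consErr_le (P := P) (I := I) hK t).trans (Real.sqrt_le_sqrt ?_)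
  have hdec : ∀ τ ≥ 0, ∑ j : Fin N × Fin n, layerRate s G P A I K c j.1 j.2 τ ≤
      -(rateP K c * lyapunov s G P I K τ ^ (2 / 3 : ℝ)
        + rateQ K c * lyapunov s G P I K τ ^ 2) + totalConst G I U K c := by
    intro τ hτ
    have h1 := Finset.sum_le_sum fun (j : Fin N × Fin n) (_ : j ∈ Finset.univ) =>
      h.layerRate_le hG hA hP hK hc hS j.1 j.2 hτ
    have h2 := rate_mul_lyapunov_le (s := s) (G := G) (P := P) (I := I) hmS hmF hK hc τ
    rw [Finset.sum_sub_distrib, Finset.sum_add_distrib, sum_coupling_eq_zero] at h1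
    rw [pLyap_eq] at h2
    rw [totalConst, ← Fintype.sum_prod_type']
    linarith
  have hV := fixedTime_bound (rateP_pos hmS hmF hK hc) (rateQ_pos hmS hmF hK hc)
    (totalConst_pos (I := I) hG hU hc hK.γ_pos) hϑ₀ hϑ₁
    (fun τ hτ => h.hasDerivWithinAt_lyapunov hA hP hK hτ) hdec
    (t := t) (by rwa [← Tmax_eq])
  rw [pLyap_eq, qLyap_eq, show (1 : ℝ) / (2 / 3) = 3 / 2 by norm_num]
  linarith

/-! ### Adjusting the radius -/

lemma layerMax_lamMax_inv_le {m : Fin N → Fin n → ℕ} (hm : ∀ i k, 0 < m i k)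
    {Γ : ∀ i k, Matrix (Fin (m i k)) (Fin (m i k)) ℝ} (hΓ : ∀ i k, (Γ i k).PosDef) {R : ℝ}
    (hR : 0 < R) (h : ∀ i k, (Γ i k - R • 1).PosSemidef) :
    R ≤ 1 / layerMax fun i k => lamMax (Γ i k)⁻¹ := by
  rw [le_one_div hR (layerMax_lamMax_inv_pos hm hΓ)]
  exact layerMax_le fun i k => lamMax_inv_le (hΓ i k) (hm i k) hR (h i k)

/-- The decay rate `rateP` grows at least like the power `pLyap` of the gains. -/
lemma exists_rateP_ge (hmS : ∀ i k, 0 < mS i k) (hmF : ∀ i k, 0 < mF i k) (hc : c.Admissible) :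
    ∃ c₀ > 0, ∀ K : Gains mS mF, K.Admissible → ∀ R ≥ 1, K.AtLeast R →
      c₀ * R ^ pLyap ≤ rateP K c := by
  have m2 := layerMin_pos hc.critic_p_pos
  have m3 := layerMin_pos hc.actor2
  have m4 := layerMin_pos hc.est1
  have m5 := layerMin_pos hc.dist1
  set c₀ : ℝ := min 1 <| min (layerMin fun i k => c.σ2c i k / 2 - c.σ2a i k) <|
    min (1 / 2 * layerMin c.σ2a) <| min (1 / 2 * layerMin c.σ1θ) (1 / 2 * layerMin c.σ1d) with hc₀
  have hc₀pos : 0 < c₀ := lt_min one_pos (lt_min m2 (lt_min (by positivity)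
    (lt_min (by positivity) (by positivity))))
  refine ⟨c₀, hc₀pos, fun K hK R hR hKR => ?_⟩
  have hR0 : 0 < R := by linarith
  have hp0 : 0 ≤ pLyap := by norm_num [pLyap_eq]
  have hp1 : pLyap ≤ 1 := by norm_num [pLyap_eq]
  have hRp : 0 ≤ R ^ pLyap := by positivity
  have hpow : ∀ {x : ℝ}, R ≤ x → R ^ pLyap ≤ x ^ pLyap := fun h =>
    Real.rpow_le_rpow hR0.le h hp0
  have hdiv : ∀ {x : ℝ}, R ≤ 1 / x → R ≤ 2 / x := fun {x} h => by
    have : 2 / x = 1 / x + 1 / x := by ring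
    linarith
  have key : ∀ {d x : ℝ}, c₀ ≤ d → R ^ pLyap ≤ x → c₀ * R ^ pLyap ≤ x * d := fun h1 h2 => by
    rw [mul_comm]
    exact mul_le_mul h2 h1 hc₀pos.le (hRp.trans h2)
  have l1 : c₀ ≤ 1 := min_le_left _ _
  have l2 : c₀ ≤ layerMin fun i k => c.σ2c i k / 2 - c.σ2a i k :=
    (min_le_right _ _).trans (min_le_left _ _)
  have l3 : c₀ ≤ 1 / 2 * layerMin c.σ2a :=
    (min_le_right _ _).trans ((min_le_right _ _).trans (min_le_left _ _))
  have l4 : c₀ ≤ 1 / 2 * layerMin c.σ1θ := (min_le_right _ _).trans ((min_le_right _ _).trans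
    ((min_le_right _ _).trans (min_le_left _ _)))
  have l5 : c₀ ≤ 1 / 2 * layerMin c.σ1d := (min_le_right _ _).trans ((min_le_right _ _).trans
    ((min_le_right _ _).trans (min_le_right _ _)))
  refine le_min ?_ (le_min ?_ (le_min ?_ (le_min ?_ ?_)))
  · have h1 : (1 : ℝ) ≤ 2 ^ pLyap := Real.one_le_rpow (by norm_num) hp0
    have h2 : R ^ pLyap ≤ layerMin K.kp :=
      (Real.rpow_le_self_of_one_le hR hp1).trans (le_layerMin hKR.kp_ge)
    have h3 := key l1 h2
    nlinarith
  · exact key l2 (hpow (hdiv (layerMax_lamMax_inv_le hmS hK.Γc_pos hR0 hKR.Γc_ge)))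
  · refine (key l3 (hpow (hdiv (layerMax_lamMax_inv_le hmS hK.Γa_pos hR0 hKR.Γa_ge)))).trans_eq ?_
    ring
  · refine (key l4 (hpow (hdiv (layerMax_lamMax_inv_le hmF hK.Γθ_pos hR0 hKR.Γθ_ge)))).trans_eq ?_
    ring
  · have h1 : R ≤ 2 * layerMin K.γ := by
      have := le_layerMin hKR.γ_ge
      linarith
    refine (key l5 (hpow h1)).trans_eq ?_
    ring

lemma exists_radiusZ_le (hmS : ∀ i k, 0 < mS i k) (hmF : ∀ i k, 0 < mF i k)
    (hG : G.HasLeaderSpanningTree) (I : IdealWeights mS mF) (hU : U.Valid) (hc : c.Admissible)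
    {ϑ : ℝ} (hϑ₁ : ϑ < 1) {ε : ℝ} (hε : 0 < ε) :
    ∃ R : ℝ, ∀ K : Gains mS mF, K.Admissible → K.AtLeast R → radiusZ G I U K c ϑ ≤ ε := by
  obtain ⟨c₀, hc₀, hrate⟩ := exists_rateP_ge hmS hmF hc
  have hσ := Topology.singMin_Ltilde_pos hG
  have h1ϑ : 0 < 1 - ϑ := by linarith
  set K₁ : Gains mS mF := ⟨fun _ _ => 0, fun _ _ => 0, fun _ _ => 0, fun _ _ => 1, fun _ _ => 0,
    fun _ _ => 0, fun _ _ => 0⟩ with hK₁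
  have hγ₁ : ∀ i k, 0 < K₁.γ i k := fun _ _ => one_pos
  set C₁ := totalConst G I U K₁ c
  have hC₁ : 0 < C₁ := totalConst_pos hG hU hc hγ₁
  set B := (C₁ / ((1 - ϑ) * c₀)) ^ (3 / 2 : ℝ) with hB
  have hB0 : 0 < B := by positivity
  refine ⟨max 1 (2 * B / (ε * singMin G.Ltilde) ^ 2), fun K hK hKR => ?_⟩
  set R := max 1 (2 * B / (ε * singMin G.Ltilde) ^ 2) with hR
  have hR1 : 1 ≤ R := le_max_left _ _
  have hR0 : 0 < R := by linarith
  have hC : totalConst G I U K c ≤ C₁ :=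
    totalConst_le hG hU hc hγ₁ fun i k => hR1.trans (hKR.γ_ge i k)
  have hC0 : 0 < totalConst G I U K c := totalConst_pos hG hU hc hK.γ_pos
  have hr := hrate K hK R hR1 hKR
  have hr0 := rateP_pos hmS hmF hK hc
  have hthr : (totalConst G I U K c / ((1 - ϑ) * rateP K c)) ^ (1 / pLyap) ≤ B / R := by
    have h1 : totalConst G I U K c / ((1 - ϑ) * rateP K c) ≤
        C₁ / ((1 - ϑ) * c₀) / R ^ (2 / 3 : ℝ) := by
      rw [div_div, mul_assoc, ← pLyap_eq]
      gcongr
    have h2 : (R ^ (2 / 3 : ℝ)) ^ (3 / 2 : ℝ) = R := by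
      rw [← Real.rpow_mul hR0.le]; norm_num
    rw [pLyap_eq, show (1 : ℝ) / (2 / 3) = 3 / 2 by norm_num]
    refine (Real.rpow_le_rpow (by positivity) h1 (by norm_num)).trans_eq ?_
    rw [Real.div_rpow (by positivity) (by positivity), h2]
  rw [radiusZ, div_le_iff₀ hσ, radiusE]
  refine Real.sqrt_le_iff.2 ⟨by positivity, ?_⟩
  have h3 : 2 * B / (ε * singMin G.Ltilde) ^ 2 ≤ R := le_max_right _ _
  rw [div_le_iff₀ (by positivity)] at h3
  have h4 : 2 * (B / R) ≤ (ε * singMin G.Ltilde) ^ 2 := by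
    rw [← mul_div_assoc, div_le_iff₀ hR0]; linarith
  exact (mul_le_mul_of_nonneg_left ((min_le_left _ _).trans hthr) two_pos.le).trans h4

end FixedTimeConsensus

theorem theorem1 {N n : ℕ} [NeZero N] [NeZero n]
    (mS mF : Fin N → Fin n → ℕ) (hmS : ∀ i k, 0 < mS i k) (hmF : ∀ i k, 0 < mF i k)
    (G : FixedTimeConsensus.Topology N) (hG : G.HasLeaderSpanningTree)
    (A : FixedTimeConsensus.Networks mS mF) (I : FixedTimeConsensus.IdealWeights mS mF)
    (U : FixedTimeConsensus.Bounds N n) (hU : U.Valid)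
    (hS : ∀ i k r, A.S i k r ⬝ᵥ A.S i k r ≤ U.lamS i k)
    (c : FixedTimeConsensus.Coeffs N n) (hc : c.Admissible)
    (ϑ : ℝ) (hϑ₀ : 0 < ϑ) (hϑ₁ : ϑ < 1) :
    (∀ K : FixedTimeConsensus.Gains mS mF, K.Admissible →
      ∀ P : FixedTimeConsensus.Plant N n, P.Standing U →
      ∀ s : FixedTimeConsensus.Signals mS mF,
        FixedTimeConsensus.IsClosedLoop G P A K c s →
        FixedTimeConsensus.ApproximatesAlong G P A I U s →
        ∃ T : ℝ, 0 ≤ T ∧ T < FixedTimeConsensus.Tmax K c / ϑ ∧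
          (9 / 10 ≤ ϑ → T < FixedTimeConsensus.Tmax K c) ∧
          ∀ t ≥ T,
            FixedTimeConsensus.eucl (s.consErr G t) ≤
              FixedTimeConsensus.radiusE G I U K c ϑ ∧
            FixedTimeConsensus.eucl (s.trackErr t) ≤
              FixedTimeConsensus.radiusZ G I U K c ϑ ∧
            ((∀ i l, G.a i l = G.a l i) →
              FixedTimeConsensus.eucl (s.trackErr t) ≤
                FixedTimeConsensus.radiusE G I U K c ϑ /
                  FixedTimeConsensus.lamMin G.Ltilde)) ∧
    (∀ ε > 0, ∃ R : ℝ, ∀ K : FixedTimeConsensus.Gains mS mF, K.Admissible → K.AtLeast R →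
      FixedTimeConsensus.radiusZ G I U K c ϑ ≤ ε) := by
  refine ⟨fun K hK P hP s hs hA => ?_, fun ε hε =>
    FixedTimeConsensus.exists_radiusZ_le hmS hmF hG I hU hc hϑ₁ hε⟩
  have hT : 0 < FixedTimeConsensus.Tmax K c := by
    have h1 := FixedTimeConsensus.rateP_pos hmS hmF hK hc
    have h2 := FixedTimeConsensus.rateQ_pos hmS hmF hK hc
    rw [FixedTimeConsensus.Tmax_eq]
    positivity
  -- At `ϑ = 9 / 10` the factor `17 / 20 / ϑ` is still below one.
  refine ⟨17 / 20 * FixedTimeConsensus.Tmax K c / ϑ, by positivity, ?_, fun hϑ => ?_,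
    fun t ht => ?_⟩
  · exact div_lt_div_of_pos_right (by linarith) hϑ₀
  · rw [div_lt_iff₀ hϑ₀]
    nlinarith
  · have he := FixedTimeConsensus.eucl_consErr_le_radiusE hmS hmF hG hU hS hc hϑ₀ hϑ₁ hK hP
      hs hA ht
    refine ⟨he, ?_, fun hsymm => ?_⟩
    · have hσ := FixedTimeConsensus.Topology.singMin_Ltilde_pos hG
      refine (FixedTimeConsensus.eucl_le_div_singMin hσ _).trans ?_
      rw [← s.consErr_eq]
      exact div_le_div_of_nonneg_right he hσ.le
    · have hσ := FixedTimeConsensus.Topology.lamMin_Ltilde_pos hG hsymm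
      refine (FixedTimeConsensus.eucl_le_div_lamMin
        (FixedTimeConsensus.Topology.isHermitian_Ltilde hsymm) hσ _).trans ?_
      rw [← s.consErr_eq]
      exact div_le_div_of_nonneg_right he hσ.le
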